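/- A \emph{ring oracle} for a finite commutative ring $R$ with unity encodes each element of $R$ by a unique string in $\{0,1\}^m$; queried with the codes of two elements $a,b\in R$, it returns the code of $a+b$ or of $ab$, as requested. An arithmetic circuit over $R$ in the variables $x_1,\dots,x_n$ has as nodes the $n$ variables, scalars from $R$, and addition and multiplication gates of fan-in two; its size is its number of nodes. It computes a polynomial $f\in R[x_1,\dots,x_n]$. Theorem. There is a single randomized algorithm (a randomized random-access machine with logarithmic cost and with access to the ring oracle, each query being charged $\Theta(m)$) which, given $m$, the codes of $0$ and $1$, and an arithmetic circuit over $R$ in $x_1,\dots,x_n$ whose scalars are given by their codes, tests whether the polynomial $f\in R[x_1,\dots,x_n]$ computed by the circuit is identically zero, for all finite commutative rings $R$ with unity, all ring oracles for $R$ and all such circuits. It always halts; if $f=0$ it always answers ``zero'', and if $f\neq 0$ it answers ``nonzero'' with probability at least $2/3$. Its worst-case running time is bounded by a fixed polynomial in the circuit size and $m$. Consequently, whenever $m$ is bounded by a fixed polynomial in $\log|R|$, the running time is bounded by a fixed polynomial in the circuit size and $\log|R|$. -/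

import Mathlib

universe u

/-! ## Arithmetic circuits over a commutative ring -/

/-- A node of an arithmetic circuit that is not a variable, preceded by `k` earlier nodes: a scalar
of `R`, or a gate of fan-in two whose inputs are earlier nodes. -/
inductive CircuitGate (R : Type u) (k : ℕ) : Type u
  | scalar (c : R) : CircuitGate R k
  | add (i j : Fin k) : CircuitGate R k
  | mul (i j : Fin k) : CircuitGate R k

/-- An arithmetic circuit over `R` in `n` variables with `s` further nodes. Its nodes are numbered
`0, …, n + s - 1` in topological order: the nodes `0, …, n - 1` are the variables, and node `n + t`
is `gate t`. The node `out` is the output. -/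
structure ArithCircuit (R : Type u) (n s : ℕ) : Type u where
  gate : (t : Fin s) → CircuitGate R (n + t)
  out : Fin (n + s)

namespace ArithCircuit

/-- The size of a circuit: its number of nodes (variables, scalars and gates). -/
def size {R : Type u} {n s : ℕ} (_C : ArithCircuit R n s) : ℕ := n + s

/-- The formal polynomial computed at node `v` (`0` if there is no such node). -/
noncomputable def value {R : Type u} [CommRing R] {n s : ℕ} (C : ArithCircuit R n s) (v : ℕ) :
    MvPolynomial (Fin n) R :=
  if h : v < n then MvPolynomial.X ⟨v, h⟩
  else if h' : v - n < s then
    match C.gate ⟨v - n, h'⟩ with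
    | .scalar c => MvPolynomial.C c
    | .add i j => C.value i + C.value j
    | .mul i j => C.value i * C.value j
  else 0
termination_by v
decreasing_by
  all_goals grind

/-- The polynomial computed by the circuit. -/
noncomputable def poly {R : Type u} [CommRing R] {n s : ℕ} (C : ArithCircuit R n s) :
    MvPolynomial (Fin n) R :=
  C.value C.out

end ArithCircuit

/-! ## Rings given by an oracle -/

/-- The two operations that a ring oracle performs. -/
inductive RingOp : Type
  | add
  | mul

/-- A presentation of the commutative ring `R` by an oracle: every element is encoded by a unique
string of `m` bits, and the oracle, queried with the codes of two elements, answers with the code of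
their sum or product. Its answers to other queries are arbitrary. -/
structure RingOracle (R : Type u) [CommRing R] (m : ℕ) : Type u where
  code : R → BitVec m
  code_injective : Function.Injective code
  query : RingOp → BitVec m → BitVec m → BitVec m
  query_add : ∀ a b : R, query RingOp.add (code a) (code b) = code (a + b)
  query_mul : ∀ a b : R, query RingOp.mul (code a) (code b) = code (a * b)

/-! ## Randomized oracle random-access machines with logarithmic cost

Programs work on finitely many program variables and on an unbounded memory that is addressed
indirectly; both hold natural numbers, that is, binary strings. A program can query a binary oracle
on strings of `m` bits and can toss fair coins. Every operation is charged the number of bits that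
it handles. -/

namespace OracleRAM

/-- The operations on natural numbers; `sub` is truncated subtraction and `div` is the quotient
rounded down, with `a / 0 = 0`. -/
inductive ArithOp : Type
  | add
  | sub
  | mul
  | div

def ArithOp.apply : ArithOp → ℕ → ℕ → ℕ
  | .add, a, b => a + b
  | .sub, a, b => a - b
  | .mul, a, b => a * b
  | .div, a, b => a / b

/-- Expressions: numerals, program variables, memory cells, and arithmetic operations. -/
inductive Expr : Type
  | lit (k : ℕ) : Expr
  | var (x : ℕ) : Expr
  | load (a : Expr) : Expr
  | op (o : ArithOp) (e f : Expr) : Expr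

/-- A state: the values of the program variables, the memory, and the coin tosses not yet used. -/
structure State : Type where
  var : ℕ → ℕ
  mem : ℕ → ℕ
  coins : List Bool

def Expr.eval (σ : State) : Expr → ℕ
  | .lit k => k
  | .var x => σ.var x
  | .load a => σ.mem (a.eval σ)
  | .op o e f => o.apply (e.eval σ) (f.eval σ)

/-- The cost of evaluating an expression: for each of its subexpressions, one plus the number of
bits of its value. -/
def Expr.cost (σ : State) : Expr → ℕ
  | .lit k => 1 + k.size
  | .var x => 1 + (σ.var x).size
  | .load a => a.cost σ + (1 + (σ.mem (a.eval σ)).size)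
  | .op o e f => e.cost σ + f.cost σ + (1 + (o.apply (e.eval σ) (f.eval σ)).size)

/-- Programs. -/
inductive Program : Type
  /-- Do nothing. -/
  | skip : Program
  /-- Assign the value of `e` to the variable `x`. -/
  | assign (x : ℕ) (e : Expr) : Program
  /-- Write the value of `e` into the memory cell whose address is the value of `a`. -/
  | store (a e : Expr) : Program
  /-- Query the oracle on the values of `e` and `f` and assign its answer to the variable `x`. -/
  | ask (o : RingOp) (x : ℕ) (e f : Expr) : Program
  /-- Toss a coin and assign the outcome, `0` or `1`, to the variable `x`. -/
  | toss (x : ℕ) : Program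
  /-- Run `c`, then `d`. -/
  | seq (c d : Program) : Program
  /-- Run `c` if the value of `e` is not `0`, and `d` otherwise. -/
  | cond (e : Expr) (c d : Program) : Program
  /-- Run `c` as long as the value of `e` is not `0`. -/
  | loop (e : Expr) (c : Program) : Program

/-- `Exec query c σ t σ'`: with the oracle `query`, the program `c` started in the state `σ` halts
in the state `σ'` after time exactly `t`. An oracle query is charged the length of the two
questions and of the answer; a number is sent to the oracle as its `m` lowest bits. -/
inductive Exec {m : ℕ} (query : RingOp → BitVec m → BitVec m → BitVec m) :
    Program → State → ℕ → State → Prop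
  | skip (σ : State) : Exec query .skip σ 1 σ
  | assign (σ : State) (x : ℕ) (e : Expr) :
      Exec query (.assign x e) σ (e.cost σ + 1)
        { σ with var := Function.update σ.var x (e.eval σ) }
  | store (σ : State) (a e : Expr) :
      Exec query (.store a e) σ (a.cost σ + e.cost σ + 1)
        { σ with mem := Function.update σ.mem (a.eval σ) (e.eval σ) }
  | ask (σ : State) (o : RingOp) (x : ℕ) (e f : Expr) :
      Exec query (.ask o x e f) σ (e.cost σ + f.cost σ + 3 * m + 1)
        { σ with
          var := Function.update σ.var x
            (query o (BitVec.ofNat m (e.eval σ)) (BitVec.ofNat m (f.eval σ))).toNat }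
  | toss (σ : State) (x : ℕ) (b : Bool) (bs : List Bool) (h : σ.coins = b :: bs) :
      Exec query (.toss x) σ 1
        { σ with var := Function.update σ.var x b.toNat, coins := bs }
  | seq {c d : Program} {σ σ₁ σ₂ : State} {t₁ t₂ : ℕ}
      (h₁ : Exec query c σ t₁ σ₁) (h₂ : Exec query d σ₁ t₂ σ₂) :
      Exec query (.seq c d) σ (t₁ + t₂) σ₂
  | cond_true {e : Expr} {c d : Program} {σ σ₁ : State} {t : ℕ}
      (he : e.eval σ ≠ 0) (h : Exec query c σ t σ₁) :
      Exec query (.cond e c d) σ (e.cost σ + 1 + t) σ₁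
  | cond_false {e : Expr} {c d : Program} {σ σ₁ : State} {t : ℕ}
      (he : e.eval σ = 0) (h : Exec query d σ t σ₁) :
      Exec query (.cond e c d) σ (e.cost σ + 1 + t) σ₁
  | loop_true {e : Expr} {c : Program} {σ σ₁ σ₂ : State} {t₁ t₂ : ℕ}
      (he : e.eval σ ≠ 0) (h₁ : Exec query c σ t₁ σ₁) (h₂ : Exec query (.loop e c) σ₁ t₂ σ₂) :
      Exec query (.loop e c) σ (e.cost σ + 1 + t₁ + t₂) σ₂
  | loop_false {e : Expr} {c : Program} {σ : State} (he : e.eval σ = 0) :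
      Exec query (.loop e c) σ (e.cost σ + 1) σ

end OracleRAM

/-! ## Randomized identity testing -/

/-- The three numbers that describe a node to the machine. -/
def gateWords {R : Type u} [CommRing R] {m k : ℕ} (O : RingOracle R m) :
    CircuitGate R k → ℕ × ℕ × ℕ
  | .scalar c => (0, (O.code c).toNat, 0)
  | .add i j => (1, i, j)
  | .mul i j => (2, i, j)

/-- The initial memory: node `n + t` is described in the cells `3 t`, `3 t + 1`, `3 t + 2`. -/
def inputMem {R : Type u} [CommRing R] {m n s : ℕ} (O : RingOracle R m) (C : ArithCircuit R n s)
    (a : ℕ) : ℕ :=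
  if h : a / 3 < s then
    let w := gateWords O (C.gate ⟨a / 3, h⟩)
    if a % 3 = 0 then w.1 else if a % 3 = 1 then w.2.1 else w.2.2
  else 0

/-- The initial values of the program variables: the length `m` of the codes, the numbers `n` and
`s`, the output node, and the codes of the zero and the unity of the ring. -/
def inputVar {R : Type u} [CommRing R] {m n s : ℕ} (O : RingOracle R m) (C : ArithCircuit R n s) :
    ℕ → ℕ
  | 1 => m
  | 2 => n
  | 3 => s
  | 4 => C.out
  | 5 => (O.code 0).toNat
  | 6 => (O.code 1).toNat
  | _ => 0

/-- The initial state of the machine on the input circuit `C`, with given coin tosses. -/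
def inputState {R : Type u} [CommRing R] {m n s : ℕ} (O : RingOracle R m) (C : ArithCircuit R n s)
    (coins : List Bool) : OracleRAM.State :=
  { var := inputVar O C, mem := inputMem O C, coins := coins }

/-- On the input circuit `C` and with the given coin tosses, the program `P` halts within time `T`
with the value `y` of the output variable `0`. -/
def Answers {R : Type u} [CommRing R] {m n s : ℕ} (P : OracleRAM.Program) (O : RingOracle R m)
    (C : ArithCircuit R n s) (T : ℕ) (coins : List Bool) (y : ℕ) : Prop :=
  ∃ t ≤ T, ∃ σ : OracleRAM.State,
    OracleRAM.Exec O.query P (inputState O C coins) t σ ∧ σ.var 0 = y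

/-- The probability that `P` halts within time `T` with answer `y`, for `T` independent fair coin
tosses (a run of time at most `T` uses at most `T` of them). -/
noncomputable def answerProb {R : Type u} [CommRing R] {m n s : ℕ} (P : OracleRAM.Program)
    (O : RingOracle R m) (C : ArithCircuit R n s) (T : ℕ) (y : ℕ) : ℝ :=
  (Nat.card {r : Fin T → Bool // Answers P O C T (List.ofFn r) y} : ℝ) / 2 ^ T

/-- Within time `T`, the program `P` tests with one-sided error whether the polynomial computed by
`C` is zero: it halts within time `T` for all coin tosses, with answer `1` ("identically zero") or
`0` ("not identically zero"); the answer is always `1` if the polynomial is zero, and it is `0` with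
probability at least `2 / 3` if the polynomial is not zero. -/
def TestsZeroWithin {R : Type u} [CommRing R] {m n s : ℕ} (P : OracleRAM.Program)
    (O : RingOracle R m) (C : ArithCircuit R n s) (T : ℕ) : Prop :=
  (∀ r : Fin T → Bool, Answers P O C T (List.ofFn r) 0 ∨ Answers P O C T (List.ofFn r) 1) ∧
  (C.poly = 0 → ∀ r : Fin T → Bool, Answers P O C T (List.ofFn r) 1) ∧
  (C.poly ≠ 0 → 2 / 3 ≤ answerProb P O C T 0)

/-! A nonzero polynomial over a finite ring may vanish at every point of the ring, so the test
computes in random extensions R[X]/(Q). Let l = (s+1)n + 2 (`modDegree`) and D = 2^(s+1). A gate at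
most doubles degrees, so f has degree below D in each variable, and the Kronecker substitution x_i ↦
X^(D^i) turns f ≠ 0 into a nonzero g in R[X] of degree below D^n = 2^(l-2) (`kronecker_ne_zero`,
`natDegree_kronecker_lt`). A round draws a monic Q of degree l and evaluates the circuit in
R[X]/(Q), whose elements are vectors of l ring elements; the powers X^(D^i) come from repeated
squaring. The round passes exactly if Q divides g, which is always so when f = 0.

For g ≠ 0 a random Q fails to divide g often enough. Reducing g modulo a maximal ideal could kill
it, but there are a residue field k of R and a nonzero h over k, of degree at most that of g, such
that each monic divisor of g reduces to a divisor of h (`exists_field_forall_monic_dvd`). Let p be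
the characteristic of k. Each element of the field with p^l elements is a root of some monic
polynomial of degree l over the prime field. At most 2^(l-2) of these elements are roots of h, and a
modulus has at most l roots, so at least a fraction 1/(2l) of the moduli over the prime field do not
divide h (`card_not_modulus_dvd`).

The machine neither knows p nor can sample R. It takes as coefficients of Q the images of random
integers of m + l bits; modulo any p ≤ |R| ≤ 2^m these are almost uniform (`card_residues_le`),
which costs another factor 2 (`two_pow_le_card_not_passes`). After 8l independent rounds the error
is at most (1 - 1/(4l))^(8l) ≤ e^(-2) ≤ 1/3.

On the machine side, `Runs` supports Hoare-style rules that carry a bound N for word lengths and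
loop counts, so that a polynomial time bound in N is read off from the program text; `wordBound`
supplies N. -/

namespace OracleRAM

/-! ### Cost calculus for structured programs -/

/-- A linear bound on the cost of an expression in terms of the size of the state. -/
def Expr.weight : Expr → ℕ
  | .lit k => 1 + k.size
  | .var _ => 1
  | .load a => a.weight + 1
  | .op _ e f => 2 * (e.weight + f.weight)

/-- Every variable and memory cell holds a number of at most `N` bits. -/
def Bounded (N : ℕ) (σ : State) : Prop :=
  (∀ x, (σ.var x).size ≤ N) ∧ ∀ a, (σ.mem a).size ≤ N

theorem size_le_self (k : ℕ) : k.size ≤ k := Nat.size_le.2 Nat.lt_two_pow_self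

theorem ArithOp.size_apply_le (o : ArithOp) (a b : ℕ) :
    (o.apply a b).size ≤ a.size + b.size + 1 := by
  have ha := Nat.lt_size_self a
  have hb := Nat.lt_size_self b
  cases o with
  | add =>
    refine Nat.size_le.2 ?_
    have h1 : 2 ^ a.size ≤ 2 ^ (a.size + b.size) := Nat.pow_le_pow_right (by norm_num) (by omega)
    have h2 : 2 ^ b.size ≤ 2 ^ (a.size + b.size) := Nat.pow_le_pow_right (by norm_num) (by omega)
    simp only [ArithOp.apply, pow_succ]
    omega
  | sub => exact (Nat.size_le_size (Nat.sub_le a b)).trans (by omega)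
  | mul =>
    refine (Nat.size_le.2 ?_ : _ ≤ a.size + b.size).trans (by omega)
    rw [pow_add]
    exact Nat.mul_lt_mul'' ha hb
  | div => exact (Nat.size_le_size (Nat.div_le_self a b)).trans (by omega)

theorem Expr.size_eval_lt_cost (σ : State) (e : Expr) : (e.eval σ).size + 1 ≤ e.cost σ := by
  cases e <;> simp only [Expr.eval, Expr.cost] <;> omega

theorem Expr.cost_le {N : ℕ} {σ : State} (hσ : Bounded N σ) (e : Expr) :
    e.cost σ ≤ e.weight * (N + 1) := by
  induction e with
  | lit k => simp only [Expr.cost, Expr.weight]; nlinarith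
  | var x => have := hσ.1 x; simp only [Expr.cost, Expr.weight]; omega
  | load a ih =>
    have := hσ.2 (a.eval σ)
    simp only [Expr.cost, Expr.weight, add_mul]; omega
  | op o e f he hf =>
    have h1 := e.size_eval_lt_cost σ
    have h2 := f.size_eval_lt_cost σ
    have h3 := o.size_apply_le (e.eval σ) (f.eval σ)
    simp only [Expr.cost, Expr.weight]
    -- The result has at most one bit more than both operands together, and each cost exceeds the
    -- length of its operand; so the charge for the result is at most the sum of the two costs.
    calc _ ≤ 2 * (e.cost σ + f.cost σ) := by omega
      _ ≤ 2 * (e.weight * (N + 1) + f.weight * (N + 1)) := by omega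
      _ = _ := by ring

open Polynomial in
/-- A polynomial bounding the running time of a program all of whose states are bounded by `N`, and
all of whose loops are run at most `N` times, in terms of `N`. -/
noncomputable def Program.time : Program → ℕ[X]
  | .skip => 1
  | .assign _ e => C e.weight * (X + 1) + 1
  | .store a e => C a.weight * (X + 1) + C e.weight * (X + 1) + 1
  | .ask _ _ e f => C e.weight * (X + 1) + C f.weight * (X + 1) + 3 * X + 1
  | .toss _ => 1
  | .seq c d => c.time + d.time
  | .cond e c d => C e.weight * (X + 1) + 1 + (c.time + d.time)
  | .loop e c => (X + 1) * (C e.weight * (X + 1) + 1 + c.time)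

/-- Started in a bounded state `σ`, the program halts in time in a bounded state satisfying `Q`. -/
def Runs {m : ℕ} (query : RingOp → BitVec m → BitVec m → BitVec m) (N : ℕ) (c : Program)
    (σ : State) (Q : State → Prop) : Prop :=
  Bounded N σ → ∃ t ≤ c.time.eval N, ∃ σ', Exec query c σ t σ' ∧ Bounded N σ' ∧ Q σ'

/-- The state in which the variable `x` has been set to `v`. -/
def State.setVar (σ : State) (x v : ℕ) : State := { σ with var := Function.update σ.var x v }

/-- The state in which the memory cell `a` has been set to `v`. -/
def State.setMem (σ : State) (a v : ℕ) : State := { σ with mem := Function.update σ.mem a v }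

theorem Bounded.setVar {N : ℕ} {σ : State} (h : Bounded N σ) {x v : ℕ} (hv : v.size ≤ N) :
    Bounded N (σ.setVar x v) := by
  refine ⟨fun y => ?_, h.2⟩
  by_cases hy : y = x
  · subst hy; simpa [State.setVar] using hv
  · simpa [State.setVar, hy] using h.1 y

theorem Bounded.setMem {N : ℕ} {σ : State} (h : Bounded N σ) {x v : ℕ} (hv : v.size ≤ N) :
    Bounded N (σ.setMem x v) := by
  refine ⟨h.1, fun y => ?_⟩
  by_cases hy : y = x
  · subst hy; simpa [State.setMem] using hv
  · simpa [State.setMem, hy] using h.2 y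

section Rules

variable {m : ℕ} {query : RingOp → BitVec m → BitVec m → BitVec m} {N : ℕ} {σ : State}
  {Q Q' : State → Prop}

theorem Runs.mono {c : Program} (h : Runs query N c σ Q') (hQ : ∀ τ, Q' τ → Q τ) :
    Runs query N c σ Q := fun hσ => by
  obtain ⟨t, ht, τ, h1, h2, h3⟩ := h hσ
  exact ⟨t, ht, τ, h1, h2, hQ τ h3⟩

theorem runs_skip (hQ : Q σ) : Runs query N .skip σ Q := fun hσ =>
  ⟨1, by simp [Program.time], σ, .skip σ, hσ, hQ⟩

theorem runs_assign {x : ℕ} {e : Expr} (he : Bounded N σ → (e.eval σ).size ≤ N)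
    (hQ : Q (σ.setVar x (e.eval σ))) : Runs query N (.assign x e) σ Q := fun hσ =>
  ⟨_, by have := e.cost_le hσ; simpa [Program.time] using this, _, .assign σ x e,
    hσ.setVar (he hσ), hQ⟩

theorem runs_store {a e : Expr} (he : Bounded N σ → (e.eval σ).size ≤ N)
    (hQ : Q (σ.setMem (a.eval σ) (e.eval σ))) : Runs query N (.store a e) σ Q := fun hσ =>
  ⟨_, by
    have h1 := e.cost_le hσ
    have h2 := a.cost_le hσ
    simpa [Program.time] using Nat.add_le_add h2 h1, _, .store σ a e,
    hσ.setMem (he hσ), hQ⟩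

theorem runs_ask {o : RingOp} {x : ℕ} {e f : Expr} (hm : m ≤ N)
    (hQ : Q (σ.setVar x
      (query o (BitVec.ofNat m (e.eval σ)) (BitVec.ofNat m (f.eval σ))).toNat)) :
    Runs query N (.ask o x e f) σ Q := fun hσ =>
  ⟨_, by
    have h1 := e.cost_le hσ
    have h2 := f.cost_le hσ
    simp only [Program.time, Polynomial.eval_add, Polynomial.eval_mul, Polynomial.eval_C,
      Polynomial.eval_X, Polynomial.eval_one, Polynomial.eval_ofNat]
    omega, _, .ask σ o x e f,
    hσ.setVar ((Nat.size_le.2 (BitVec.isLt _)).trans hm), hQ⟩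

theorem runs_toss {x : ℕ} {b : Bool} {bs : List Bool} (hN : 1 ≤ N) (hc : σ.coins = b :: bs)
    (hQ : Q { σ.setVar x b.toNat with coins := bs }) : Runs query N (.toss x) σ Q := fun hσ =>
  ⟨1, by simp [Program.time], _, .toss σ x b bs hc,
    hσ.setVar ((size_le_self _).trans ((Bool.toNat_le b).trans hN)), hQ⟩

theorem runs_seq {c d : Program} (h : Runs query N c σ fun τ => Runs query N d τ Q) :
    Runs query N (.seq c d) σ Q := fun hσ => by
  obtain ⟨t, ht, τ, h1, h2, h3⟩ := h hσ
  obtain ⟨t', ht', τ', h1', h2', h3'⟩ := h3 h2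
  exact ⟨t + t', by simpa [Program.time] using Nat.add_le_add ht ht', τ', h1.seq h1', h2', h3'⟩

theorem runs_cond {e : Expr} {c d : Program} (h1 : e.eval σ ≠ 0 → Runs query N c σ Q)
    (h2 : e.eval σ = 0 → Runs query N d σ Q) : Runs query N (.cond e c d) σ Q := fun hσ => by
  have he := e.cost_le hσ
  by_cases h : e.eval σ = 0
  · obtain ⟨t, ht, τ, h1, h2, h3⟩ := h2 h hσ
    refine ⟨_, ?_, τ, .cond_false h h1, h2, h3⟩
    simp only [Program.time, Polynomial.eval_add, Polynomial.eval_mul, Polynomial.eval_C,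
      Polynomial.eval_X, Polynomial.eval_one]
    omega
  · obtain ⟨t, ht, τ, h1, h2, h3⟩ := h1 h hσ
    refine ⟨_, ?_, τ, .cond_true h h1, h2, h3⟩
    simp only [Program.time, Polynomial.eval_add, Polynomial.eval_mul, Polynomial.eval_C,
      Polynomial.eval_X, Polynomial.eval_one]
    omega

/-- `for x = e - 1, …, 0 do c`. -/
def Program.forDown (x : ℕ) (e : Expr) (c : Program) : Program :=
  .seq (.assign x e)
    (.loop (.var x) (.seq (.assign x (.op .sub (.var x) (.lit 1))) c))

/-- The counter is decremented before the body, so the body sees k = e - 1, …, 0, and `I k`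
describes the state with k iterations to go. The body has to preserve the counter. At most N
iterations and one final test of the guard account for the factor X + 1 in `Program.time`. -/
theorem runs_forDown {x : ℕ} {e : Expr} {c : Program} (I : ℕ → State → Prop)
    (he : e.eval σ ≤ N) (h0 : I (e.eval σ) (σ.setVar x (e.eval σ)))
    (hstep : ∀ k < e.eval σ, ∀ τ, I (k + 1) τ →
      Runs query N c (τ.setVar x k) fun τ' => τ'.var x = k ∧ I k τ')
    (hend : ∀ τ, τ.var x = 0 → I 0 τ → Q τ) : Runs query N (.forDown x e c) σ Q := by
  refine runs_seq (runs_assign (fun _ => (size_le_self _).trans he) ?_)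
  set body : Program := .seq (.assign x (.op .sub (.var x) (.lit 1))) c with hbody
  set A := (Expr.var x).weight * (N + 1) + 1 + body.time.eval N with hA
  have key : ∀ k ≤ e.eval σ, ∀ τ, τ.var x = k → I k τ → Bounded N τ →
      ∃ t ≤ (k + 1) * A, ∃ τ', Exec query (.loop (.var x) body) τ t τ' ∧ Bounded N τ' ∧ Q τ' := by
    intro k
    induction k with
    | zero =>
      intro _ τ hx hI hτ
      have hc := (Expr.var x).cost_le hτ
      exact ⟨_, by rw [hA]; omega, τ, .loop_false hx, hτ, hend τ hx hI⟩
    | succ k ih =>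
      intro hk τ hx hI hτ
      have hc := (Expr.var x).cost_le hτ
      have hev : (Expr.op .sub (.var x) (.lit 1)).eval τ = k := by
        simp [Expr.eval, ArithOp.apply, hx]
      have hb : Runs query N body τ fun τ' => τ'.var x = k ∧ I k τ' := by
        refine runs_seq (runs_assign (fun _ => ?_) ?_)
        · rw [hev]; exact (size_le_self _).trans (by omega)
        · rw [hev]; exact hstep k (by omega) τ hI
      obtain ⟨t, ht, τ', h1, h2, h3, h4⟩ := hb hτ
      obtain ⟨t', ht', τ'', h1', h2', h3'⟩ := ih (by omega) τ' h3 h4 h2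
      refine ⟨_, ?_, τ'', .loop_true (by simp [Expr.eval, hx]) h1 h1', h2', h3'⟩
      rw [add_mul _ 1 A, one_mul]
      omega
  intro hσ
  obtain ⟨t, ht, r⟩ := key _ le_rfl _ (by simp [State.setVar]) h0 hσ
  refine ⟨t, ht.trans ?_, r⟩
  have : (Program.loop (.var x) body).time.eval N = (N + 1) * A := by
    simp [Program.time, hA]
  rw [this]
  gcongr

end Rules

end OracleRAM

/-! ### Coordinates with respect to powers of θ -/

open Finset

/-- The degree of the random modulus. -/
def modDegree (n s : ℕ) : ℕ := (s + 1) * n + 2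

section Residues

variable {R A : Type*} [CommRing R] [CommRing A] [Algebra R A]

/-- The element of the `R`-algebra `A` with the given coordinates with respect to the first `l`
powers of `θ`. -/
def powerSum (θ : A) (l : ℕ) (v : ℕ → R) : A := ∑ i ∈ range l, algebraMap R A (v i) * θ ^ i

theorem powerSum_congr {θ : A} {l : ℕ} {v w : ℕ → R} (h : ∀ i < l, v i = w i) :
    powerSum θ l v = powerSum θ l w :=
  sum_congr rfl fun i hi => by rw [h i (mem_range.1 hi)]

theorem powerSum_add (θ : A) (l : ℕ) (v w : ℕ → R) :
    powerSum θ l (fun i => v i + w i) = powerSum θ l v + powerSum θ l w := by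
  simp [powerSum, add_mul, sum_add_distrib]

theorem powerSum_smul (θ : A) (l : ℕ) (c : R) (v : ℕ → R) :
    powerSum θ l (fun i => c * v i) = algebraMap R A c * powerSum θ l v := by
  simp [powerSum, mul_sum, mul_assoc]

theorem powerSum_zero (θ : A) (l : ℕ) : powerSum θ l (fun _ => (0 : R)) = 0 := by
  simp [powerSum]

theorem powerSum_single {θ : A} {l j : ℕ} (hj : j < l) (c : R) :
    powerSum θ l (fun i => if i = j then c else 0) = algebraMap R A c * θ ^ j := by
  rw [powerSum, sum_eq_single j]
  · simp
  · intro b _ hb; simp [hb]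
  · intro h; exact absurd (mem_range.2 hj) h

/-- Multiplication by θ moves the coordinates up by one, and the overflowing term `v (l - 1) * θ ^
l` is rewritten by `hq`. Only this relation is used, so no freeness of the powers of θ is needed. -/
theorem powerSum_shift {θ : A} {l : ℕ} (hl : l ≠ 0) {q : ℕ → R} (hq : θ ^ l = powerSum θ l q)
    (v : ℕ → R) :
    powerSum θ l (fun i => (if i = 0 then 0 else v (i - 1)) + v (l - 1) * q i) =
      θ * powerSum θ l v := by
  obtain ⟨k, rfl⟩ := Nat.exists_eq_succ_of_ne_zero hl
  rw [powerSum_add, powerSum_smul, ← hq]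
  simp only [powerSum]
  rw [sum_range_succ', sum_range_succ]
  simp only [Nat.add_eq_zero_iff, one_ne_zero, and_false, if_false, if_true, map_zero, zero_mul,
    add_zero, Nat.add_sub_cancel, Nat.succ_eq_add_one, mul_add, mul_sum]
  congr 1
  · exact sum_congr rfl fun i _ => by ring
  · ring

end Residues

/-! ### Memory layout and the machine invariant -/

namespace OracleRAM

/-- The address of coordinate `j` of slot `k`. -/
def cell (k j : Expr) : Expr :=
  .op .add (.op .add (.op .mul (.lit 3) (.var 3)) (.op .mul (.var 7) k)) j

section Invariant

variable {R : Type u} [CommRing R] {m n s : ℕ} (O : RingOracle R m) (C : ArithCircuit R n s)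

/-- The state `σ` holds the input, the codes of the vectors `S k`, the values `vs x` of
the variables `x < L` that may change, and the coins `cs`. -/
structure Inv (L : ℕ) (σ : State) (vs : ℕ → ℕ) (cs : List Bool) (S : ℕ → ℕ → R) : Prop where
  var1 : σ.var 1 = m
  var2 : σ.var 2 = n
  var3 : σ.var 3 = s
  var4 : σ.var 4 = C.out
  var5 : σ.var 5 = (O.code 0).toNat
  var6 : σ.var 6 = (O.code 1).toNat
  var7 : σ.var 7 = modDegree n s
  var8 : σ.var 8 = m + modDegree n s
  vars : ∀ x < L, x = 0 ∨ 9 ≤ x → σ.var x = vs x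
  coins : σ.coins = cs
  input : ∀ a < 3 * s, σ.mem a = inputMem O C a
  slots : ∀ k < n + s + 3, ∀ j < modDegree n s,
    σ.mem (3 * s + modDegree n s * k + j) = (O.code (S k j)).toNat

variable {O C} {L : ℕ} {σ : State} {vs : ℕ → ℕ} {cs : List Bool} {S : ℕ → ℕ → R}

theorem Inv.setTemp (h : Inv O C L σ vs cs S) {x : ℕ} (v : ℕ) (hx : L ≤ x) (hx9 : 9 ≤ x) :
    Inv O C L (σ.setVar x v) vs cs S := by
  have key : ∀ y, y < L ∨ y < 9 → (σ.setVar x v).var y = σ.var y := fun y hy => by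
    simp [State.setVar, show y ≠ x by omega]
  refine ⟨?_, ?_, ?_, ?_, ?_, ?_, ?_, ?_, ?_, h.coins, h.input, h.slots⟩
  · rw [key _ (by omega), h.var1]
  · rw [key _ (by omega), h.var2]
  · rw [key _ (by omega), h.var3]
  · rw [key _ (by omega), h.var4]
  · rw [key _ (by omega), h.var5]
  · rw [key _ (by omega), h.var6]
  · rw [key _ (by omega), h.var7]
  · rw [key _ (by omega), h.var8]
  · intro y hy hy'; rw [key _ (by omega), h.vars y hy hy']

theorem Inv.setVar (h : Inv O C L σ vs cs S) {x : ℕ} (v : ℕ) (hx : x = 0 ∨ 9 ≤ x) :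
    Inv O C L (σ.setVar x v) (Function.update vs x v) cs S := by
  have key : ∀ y, 0 < y → y < 9 → (σ.setVar x v).var y = σ.var y := fun y hy hy' => by
    simp [State.setVar, show y ≠ x by omega]
  refine ⟨?_, ?_, ?_, ?_, ?_, ?_, ?_, ?_, ?_, h.coins, h.input, h.slots⟩
  · rw [key _ (by omega) (by omega), h.var1]
  · rw [key _ (by omega) (by omega), h.var2]
  · rw [key _ (by omega) (by omega), h.var3]
  · rw [key _ (by omega) (by omega), h.var4]
  · rw [key _ (by omega) (by omega), h.var5]
  · rw [key _ (by omega) (by omega), h.var6]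
  · rw [key _ (by omega) (by omega), h.var7]
  · rw [key _ (by omega) (by omega), h.var8]
  · intro y hy hy'
    by_cases hyx : y = x
    · subst hyx; simp [State.setVar]
    · simp [State.setVar, hyx, h.vars y hy hy']

/-- The bound L is a calling convention: code run at level L may overwrite the variables from L on,
apart from the input. Before a call, `Inv.raise` freezes the current values below the bound of the
callee; after it, this lemma returns to the bound and the recorded values of the caller. -/
theorem Inv.lower {L' : ℕ} {vs' : ℕ → ℕ} (h : Inv O C L' σ vs' cs S) (hL : L ≤ L')
    (hv : ∀ x < L, x = 0 ∨ 9 ≤ x → vs' x = vs x) : Inv O C L σ vs cs S :=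
  { h with vars := fun x hx hx' => by rw [h.vars x (by omega) hx', hv x hx hx'] }

theorem Inv.raise (h : Inv O C L σ vs cs S) (L' : ℕ) : Inv O C L' σ σ.var cs S :=
  { h with vars := fun _ _ _ => rfl }

theorem Inv.congr {S' : ℕ → ℕ → R} (h : Inv O C L σ vs cs S)
    (hS : ∀ k, ∀ j < modDegree n s, S k j = S' k j) : Inv O C L σ vs cs S' :=
  { h with slots := fun k hk j hj => by rw [h.slots k hk j hj, hS k j hj] }

theorem Inv.setCoins (h : Inv O C L σ vs cs S) (cs' : List Bool) :
    Inv O C L { σ with coins := cs' } vs cs' S :=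
  ⟨h.var1, h.var2, h.var3, h.var4, h.var5, h.var6, h.var7, h.var8, h.vars, rfl, h.input, h.slots⟩

theorem slot_address_inj {l k j k' j' : ℕ} (hj : j < l) (hj' : j' < l)
    (h : l * k + j = l * k' + j') : k = k' ∧ j = j' := by
  have hl : 0 < l := by omega
  have h1 := congrArg (· / l) h
  have h2 := congrArg (· % l) h
  simpa [Nat.mul_add_div hl, Nat.mul_add_mod, Nat.div_eq_of_lt, Nat.mod_eq_of_lt, hj, hj'] using
    And.intro h1 h2

theorem Inv.store (h : Inv O C L σ vs cs S) {k j : ℕ} (r : R) (hj : j < modDegree n s) :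
    Inv O C L (σ.setMem (3 * s + modDegree n s * k + j) (O.code r).toNat) vs cs
      (Function.update S k (Function.update (S k) j r)) := by
  refine ⟨h.var1, h.var2, h.var3, h.var4, h.var5, h.var6, h.var7, h.var8, h.vars, h.coins,
    fun a ha => ?_, fun k' hk' j' hj' => ?_⟩
  · have : a ≠ 3 * s + modDegree n s * k + j := by omega
    simp [State.setMem, this, h.input a ha]
  · by_cases he : k' = k ∧ j' = j
    · obtain ⟨rfl, rfl⟩ := he; simp [State.setMem]
    · have hne : 3 * s + modDegree n s * k' + j' ≠ 3 * s + modDegree n s * k + j := fun h' =>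
        he (slot_address_inj hj' hj (by omega))
      simp only [State.setMem, Function.update_of_ne hne]
      rw [h.slots k' hk' j' hj']
      by_cases hk : k' = k
      · subst hk
        rw [Function.update_self, Function.update_of_ne fun h' => he ⟨rfl, h'⟩]
      · rw [Function.update_of_ne hk]

theorem Inv.eval_cell (h : Inv O C L σ vs cs S) (k j : Expr) :
    (cell k j).eval σ = 3 * s + modDegree n s * k.eval σ + j.eval σ := by
  simp [cell, Expr.eval, ArithOp.apply, h.var3, h.var7]

theorem Inv.eval_load (h : Inv O C L σ vs cs S) {k j : Expr} (hk : k.eval σ < n + s + 3)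
    (hj : j.eval σ < modDegree n s) :
    (Expr.load (cell k j)).eval σ = (O.code (S (k.eval σ) (j.eval σ))).toNat := by
  rw [Expr.eval, h.eval_cell, h.slots _ hk _ hj]

variable {N : ℕ} {Q : State → Prop}

theorem runs_ask_add {x : ℕ} {e f : Expr} {a b : R} (hm : m ≤ N)
    (he : e.eval σ = (O.code a).toNat) (hf : f.eval σ = (O.code b).toNat)
    (hQ : Q (σ.setVar x (O.code (a + b)).toNat)) : Runs O.query N (.ask .add x e f) σ Q :=
  runs_ask hm (by simpa [he, hf, O.query_add] using hQ)

theorem runs_ask_mul {x : ℕ} {e f : Expr} {a b : R} (hm : m ≤ N)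
    (he : e.eval σ = (O.code a).toNat) (hf : f.eval σ = (O.code b).toNat)
    (hQ : Q (σ.setVar x (O.code (a * b)).toNat)) : Runs O.query N (.ask .mul x e f) σ Q :=
  runs_ask hm (by simpa [he, hf, O.query_mul] using hQ)

theorem size_code_le (hm : m ≤ N) (r : R) : (O.code r).toNat.size ≤ N :=
  (Nat.size_le.2 (BitVec.isLt _)).trans hm

theorem Inv.runs_store (h : Inv O C L σ vs cs S) {k j e : Expr} {r : R} (hm : m ≤ N)
    (hj : j.eval σ < modDegree n s) (he : e.eval σ = (O.code r).toNat)
    (hQ : ∀ τ, τ.var = σ.var → Inv O C L τ vs cs (Function.update S (k.eval σ)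
      (Function.update (S (k.eval σ)) (j.eval σ) r)) → Q τ) :
    Runs O.query N (.store (cell k j) e) σ Q := by
  refine OracleRAM.runs_store (fun _ => by rw [he]; exact size_code_le hm r) ?_
  rw [he, h.eval_cell]
  exact hQ _ rfl (h.store r hj)

/-- A loop that fills slot `d` from the top. -/
theorem Inv.runs_fill (h : Inv O C 30 σ vs cs S) {body : Program} (d : ℕ) (new : ℕ → R)
    (hN : modDegree n s ≤ N)
    (hbody : ∀ k < modDegree n s, ∀ τ S', τ.var 30 = k → Inv O C 30 τ vs cs S' →
      (∀ i, i ≠ d → S' i = S i) → (∀ i ≤ k, S' d i = S d i) →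
      Runs O.query N body τ fun τ' => τ'.var 30 = k ∧
        Inv O C 30 τ' vs cs (Function.update S' d (Function.update (S' d) k (new k)))) :
    Runs O.query N (.forDown 30 (.var 7) body) σ fun τ =>
      Inv O C 30 τ vs cs (Function.update S d new) := by
  -- With k iterations to go, the coordinates from k on are new and those below k are still old;
  -- in-place updates rely on the latter.
  set F : ℕ → ℕ → ℕ → R := fun k => Function.update S d fun i => if k ≤ i then new i else S d i
    with hF
  have hl : (Expr.var 7).eval σ = modDegree n s := h.var7
  refine runs_forDown (fun k τ => Inv O C 30 τ vs cs (F k)) (by rw [hl]; exact hN) ?_ ?_ ?_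
  · rw [hl]
    refine (h.setTemp _ le_rfl (by norm_num)).congr fun k j hj => ?_
    by_cases hk : k = d
    · subst hk; simp [hF, show ¬ modDegree n s ≤ j by omega]
    · simp [hF, hk]
  · rw [hl]
    intro k hk τ hτ
    refine (hbody k hk _ _ (by simp [State.setVar]) (hτ.setTemp k le_rfl (by norm_num))
      (fun i hi => by simp [hF, hi]) (fun i hi => by simp [hF, show ¬ k + 1 ≤ i by omega])).mono ?_
    rintro τ' ⟨h1, h2⟩
    refine ⟨h1, ?_⟩
    convert h2 using 1
    funext i j
    by_cases hi : i = d
    · subst hi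
      by_cases hj : j = k
      · subst hj; simp [hF]
      · have : k ≤ j ↔ k + 1 ≤ j := by omega
        simp [hF, hj, this]
    · simp [hF, hi]
  · intro τ _ hτ
    simpa [hF] using hτ

end Invariant

end OracleRAM

/-! ### Programs for arithmetic of residues -/

/-- A bound for the lengths of all the numbers that the machine handles and for the numbers of
iterations of its loops. -/
def wordBound (m n s : ℕ) : ℕ := modDegree n s * (n + s + 3) + 8 * modDegree n s + m + n + s + 3

namespace OracleRAM

/-- Fill slot `d` with zeros. -/
def zeroProgram (d : Expr) : Program := .forDown 30 (.var 7) (.store (cell d (.var 30)) (.var 5))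

/-- Copy slot `a` to slot `d`. -/
def copyProgram (d a : Expr) : Program :=
  .forDown 30 (.var 7) (.store (cell d (.var 30)) (.load (cell a (.var 30))))

/-- Add the slots given by the variables `21` and `22` into the slot given by the variable `20`. -/
def addProgram : Program :=
  .forDown 30 (.var 7) (.seq
    (.ask .add 31 (.load (cell (.var 21) (.var 30))) (.load (cell (.var 22) (.var 30))))
    (.store (cell (.var 20) (.var 30)) (.var 31)))

/-- Replace the residue `r` in slot `1` by `θ r + a b`, where the variable `24` holds the scalar `a`
and the variable `22` the slot of `b`; the variable `23` holds the leading coordinate of `r`. -/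
def hornerProgram : Program :=
  .forDown 30 (.var 7) (.seq
    (.cond (.var 30)
      (.assign 31 (.load (cell (.lit 1) (.op .sub (.var 30) (.lit 1)))))
      (.assign 31 (.var 5))) (.seq
    (.ask .mul 32 (.var 23) (.load (cell (.lit 0) (.var 30)))) (.seq
    (.ask .add 31 (.var 31) (.var 32)) (.seq
    (.ask .mul 32 (.var 24) (.load (cell (.var 22) (.var 30)))) (.seq
    (.ask .add 31 (.var 31) (.var 32))
    (.store (cell (.lit 1) (.var 30)) (.var 31)))))))

/-- Multiply the residues in the slots given by the variables `21` and `22` into the slot given by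
the variable `20`. -/
def mulProgram : Program :=
  .seq (zeroProgram (.lit 1)) (.seq
    (.forDown 25 (.var 7) (.seq
      (.assign 23 (.load (cell (.lit 1) (.op .sub (.var 7) (.lit 1))))) (.seq
      (.assign 24 (.load (cell (.var 21) (.var 25))))
      hornerProgram)))
    (copyProgram (.var 20) (.lit 1)))

section Specifications

variable {R : Type u} [CommRing R] {m n s : ℕ} {O : RingOracle R m} {C : ArithCircuit R n s}
  {L : ℕ} {σ : State} {vs : ℕ → ℕ} {cs : List Bool} {S : ℕ → ℕ → R} {N : ℕ}

theorem Inv.zeroProgram (h : Inv O C 30 σ vs cs S) (hN : wordBound m n s ≤ N) {e : Expr} {d : ℕ}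
    (he : ∀ τ S', Inv O C 30 τ vs cs S' → e.eval τ = d) :
    Runs O.query N (zeroProgram e) σ fun τ =>
      Inv O C 30 τ vs cs (Function.update S d fun _ => 0) := by
  unfold wordBound at hN
  refine h.runs_fill d (fun _ => 0) (by omega) ?_
  intro k hk τ S' hτ h' _ _
  have hd := he τ S' h'
  refine h'.runs_store (r := 0) (by omega) (by simpa [Expr.eval, hτ] using hk) h'.var5 ?_
  intro τ' hv hτ'
  rw [hd] at hτ'
  refine ⟨by rw [hv, hτ], ?_⟩
  simpa [Expr.eval, hτ] using hτ'

theorem Inv.copyProgram (h : Inv O C 30 σ vs cs S) (hN : wordBound m n s ≤ N) {e f : Expr} {d a : ℕ}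
    (he : ∀ τ S', Inv O C 30 τ vs cs S' → e.eval τ = d)
    (hf : ∀ τ S', Inv O C 30 τ vs cs S' → f.eval τ = a) (ha : a < n + s + 3) (had : a ≠ d) :
    Runs O.query N (copyProgram e f) σ fun τ =>
      Inv O C 30 τ vs cs (Function.update S d (S a)) := by
  unfold wordBound at hN
  refine h.runs_fill d (S a) (by omega) ?_
  intro k hk τ S' hτ h' h1 _
  have hd := he τ S' h'
  have ha' := hf τ S' h'
  have hk' : (Expr.var 30).eval τ = k := hτ
  refine h'.runs_store (r := S a k) (by omega) (by rwa [hk']) ?_ ?_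
  · rw [h'.eval_load (by rwa [ha']) (by rwa [hk']), ha', hk', h1 a had]
  intro τ' hv hτ'
  rw [hd, hk'] at hτ'
  exact ⟨by rw [hv, hτ], hτ'⟩

theorem Inv.addProgram (h : Inv O C 30 σ vs cs S) (hN : wordBound m n s ≤ N)
    (ha : vs 21 < n + s + 3) (hb : vs 22 < n + s + 3) (had : vs 21 ≠ vs 20) (hbd : vs 22 ≠ vs 20) :
    Runs O.query N addProgram σ fun τ =>
      Inv O C 30 τ vs cs (Function.update S (vs 20) fun i => S (vs 21) i + S (vs 22) i) := by
  unfold wordBound at hN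
  refine h.runs_fill _ _ (by omega) ?_
  intro k hk τ S' hτ h' h1 _
  have hk' : (Expr.var 30).eval τ = k := hτ
  have ha' : (Expr.var 21).eval τ = vs 21 := h'.vars 21 (by norm_num) (by norm_num)
  have hb' : (Expr.var 22).eval τ = vs 22 := h'.vars 22 (by norm_num) (by norm_num)
  refine runs_seq (runs_ask_add (a := S (vs 21) k) (b := S (vs 22) k) (by omega) ?_ ?_ ?_)
  · rw [h'.eval_load (by rwa [ha']) (by rwa [hk']), ha', hk', h1 _ had]
  · rw [h'.eval_load (by rwa [hb']) (by rwa [hk']), hb', hk', h1 _ hbd]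
  have h2 := h'.setTemp (x := 31) (O.code (S (vs 21) k + S (vs 22) k)).toNat (by norm_num)
    (by norm_num)
  set τ₂ := τ.setVar 31 (O.code (S (vs 21) k + S (vs 22) k)).toNat with hτ₂
  have hk₂ : (Expr.var 30).eval τ₂ = k := by simpa [hτ₂, Expr.eval, State.setVar] using hτ
  have hd₂ : (Expr.var 20).eval τ₂ = vs 20 := h2.vars 20 (by norm_num) (by norm_num)
  refine h2.runs_store (r := S (vs 21) k + S (vs 22) k) (by omega) (by rwa [hk₂])
    (by simp [hτ₂, Expr.eval, State.setVar]) ?_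
  intro τ' hv hτ'
  rw [hd₂, hk₂] at hτ'
  exact ⟨by rw [hv]; exact hk₂, hτ'⟩

/-- The update is done in place: going down, coordinate k needs only the old coordinates k - 1 and,
for the reduction, l - 1. The first is not yet overwritten; the second is lost first, and so was
saved as t. -/
theorem Inv.hornerProgram (h : Inv O C 30 σ vs cs S) (hN : wordBound m n s ≤ N) {a t : R}
    (ht : vs 23 = (O.code t).toNat) (ha : vs 24 = (O.code a).toNat)
    (hb : vs 22 < n + s + 3) (hb1 : vs 22 ≠ 1) :
    Runs O.query N hornerProgram σ fun τ =>
      Inv O C 30 τ vs cs (Function.update S 1 fun i =>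
        ((if i = 0 then 0 else S 1 (i - 1)) + t * S 0 i) + a * S (vs 22) i) := by
  unfold wordBound at hN
  refine h.runs_fill _ _ (by omega) ?_
  intro k hk τ S' hτ h' h1 h2
  set r₁ : R := if k = 0 then 0 else S 1 (k - 1) with hr₁
  have hassign : Runs O.query N (.cond (.var 30)
      (.assign 31 (.load (cell (.lit 1) (.op .sub (.var 30) (.lit 1)))))
      (.assign 31 (.var 5))) τ fun τ' => τ' = τ.setVar 31 (O.code r₁).toNat := by
    refine runs_cond (fun h0 => ?_) fun h0 => ?_
    · have hk0 : k ≠ 0 := by simpa [Expr.eval, hτ] using h0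
      have hs : (Expr.op .sub (.var 30) (.lit 1)).eval τ = k - 1 := by
        simp [Expr.eval, ArithOp.apply, hτ]
      have hev : (Expr.load (cell (.lit 1) (.op .sub (.var 30) (.lit 1)))).eval τ =
          (O.code r₁).toNat := by
        rw [h'.eval_load (by simp only [Expr.eval]; omega) (by rw [hs]; omega), hs]
        simp [Expr.eval, hr₁, hk0, h2]
      exact runs_assign (fun _ => by rw [hev]; exact size_code_le (by omega) _) (by rw [hev])
    · have hk0 : k = 0 := by simpa [Expr.eval, hτ] using h0
      have hev : (Expr.var 5).eval τ = (O.code r₁).toNat := by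
        simpa [Expr.eval, hr₁, hk0] using h'.var5
      exact runs_assign (fun _ => by rw [hev]; exact size_code_le (by omega) _) (by rw [hev])
  refine runs_seq (hassign.mono ?_)
  rintro _ rfl
  have I₁ := h'.setTemp (x := 31) (O.code r₁).toNat (by norm_num) (by norm_num)
  set τ₁ := τ.setVar 31 (O.code r₁).toNat with hτ₁
  have k₁ : (Expr.var 30).eval τ₁ = k := by simpa [hτ₁, Expr.eval, State.setVar] using hτ
  have t₁ : (Expr.var 23).eval τ₁ = _ := (I₁.vars 23 (by norm_num) (by norm_num)).trans ht
  have e₁ : (Expr.load (cell (.lit 0) (.var 30))).eval τ₁ = (O.code (S 0 k)).toNat := by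
    rw [I₁.eval_load (by simp only [Expr.eval]; omega) (by rwa [k₁]), k₁]
    simp [Expr.eval, h1]
  refine runs_seq (runs_ask_mul (by omega) t₁ e₁ ?_)
  have I₂ := I₁.setTemp (x := 32) (O.code (t * S 0 k)).toNat (by norm_num) (by norm_num)
  set τ₂ := τ₁.setVar 32 (O.code (t * S 0 k)).toNat with hτ₂
  have k₂ : (Expr.var 30).eval τ₂ = k := k₁
  refine runs_seq (runs_ask_add (a := r₁) (b := t * S 0 k) (by omega)
    (by simp [hτ₂, hτ₁, Expr.eval, State.setVar]) (by simp [hτ₂, Expr.eval, State.setVar]) ?_)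
  have I₃ := I₂.setTemp (x := 31) (O.code (r₁ + t * S 0 k)).toNat (by norm_num) (by norm_num)
  set τ₃ := τ₂.setVar 31 (O.code (r₁ + t * S 0 k)).toNat with hτ₃
  have k₃ : (Expr.var 30).eval τ₃ = k := k₂
  have a₃ : (Expr.var 24).eval τ₃ = _ := (I₃.vars 24 (by norm_num) (by norm_num)).trans ha
  have b₃ : (Expr.var 22).eval τ₃ = vs 22 := I₃.vars 22 (by norm_num) (by norm_num)
  have e₃ : (Expr.load (cell (.var 22) (.var 30))).eval τ₃ = (O.code (S (vs 22) k)).toNat := by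
    rw [I₃.eval_load (by rwa [b₃]) (by rwa [k₃]), k₃, b₃, h1 _ hb1]
  refine runs_seq (runs_ask_mul (by omega) a₃ e₃ ?_)
  have I₄ := I₃.setTemp (x := 32) (O.code (a * S (vs 22) k)).toNat (by norm_num) (by norm_num)
  set τ₄ := τ₃.setVar 32 (O.code (a * S (vs 22) k)).toNat with hτ₄
  have k₄ : (Expr.var 30).eval τ₄ = k := k₃
  refine runs_seq (runs_ask_add (a := r₁ + t * S 0 k) (b := a * S (vs 22) k) (by omega)
    (by simp [hτ₄, hτ₃, Expr.eval, State.setVar]) (by simp [hτ₄, Expr.eval, State.setVar]) ?_)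
  have I₅ := I₄.setTemp (x := 31) (O.code (r₁ + t * S 0 k + a * S (vs 22) k)).toNat (by norm_num)
    (by norm_num)
  set τ₅ := τ₄.setVar 31 (O.code (r₁ + t * S 0 k + a * S (vs 22) k)).toNat with hτ₅
  have k₅ : (Expr.var 30).eval τ₅ = k := k₄
  refine I₅.runs_store (r := r₁ + t * S 0 k + a * S (vs 22) k) (by omega)
    (by rwa [k₅]) (by simp [hτ₅, Expr.eval, State.setVar]) ?_
  intro τ' hv hτ'
  rw [k₅] at hτ'
  exact ⟨by rw [hv]; exact k₅, hτ'⟩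

/-- Horner's rule in the first operand: each step replaces the accumulator r in slot 1 by θ r + a_k
b, from the top coefficient down. Copying the product only at the end allows the destination to be
one of the operands, as in squaring. -/
theorem Inv.mulProgram {A : Type*} [CommRing A] [Algebra R A] {θ : A}
    (h : Inv O C 23 σ vs cs S) (hN : wordBound m n s ≤ N)
    (hθ : θ ^ modDegree n s = powerSum θ (modDegree n s) (S 0))
    (ha : vs 21 < n + s + 3) (hb : vs 22 < n + s + 3) (hd : vs 20 ≠ 1) (ha1 : vs 21 ≠ 1)
    (hb1 : vs 22 ≠ 1) :
    Runs O.query N mulProgram σ fun τ => ∃ S', Inv O C 23 τ vs cs S' ∧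
      (∀ i, i ≠ 1 → i ≠ vs 20 → S' i = S i) ∧
      powerSum θ (modDegree n s) (S' (vs 20)) =
        powerSum θ (modDegree n s) (S (vs 21)) * powerSum θ (modDegree n s) (S (vs 22)) := by
  set l := modDegree n s with hl
  have hl2 : 2 ≤ l := by simp [hl, modDegree]
  have hN' := hN
  unfold wordBound at hN'
  have h30 := h.raise 30
  refine runs_seq ((h30.zeroProgram hN (d := 1) (fun _ _ _ => rfl)).mono ?_)
  intro τ hτ
  have hτ0 : Inv O C 23 τ vs cs (Function.update S 1 fun _ => 0) :=
    hτ.lower (by norm_num) fun x hx hx' => h.vars x hx hx'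
  have hev : (Expr.var 7).eval τ = l := hτ0.var7
  -- The partial Horner value is the sum of a_i θ^(i-k) b over i ≥ k; multiplied by θ^k it becomes a
  -- plain tail of the product, which is the whole product at k = 0.
  refine runs_seq (runs_forDown (fun k τ => ∃ S', Inv O C 23 τ vs cs S' ∧
    (∀ i, i ≠ 1 → S' i = S i) ∧
    powerSum θ l (S' 1) * θ ^ k = (∑ i ∈ Ico k l, algebraMap R A (S (vs 21) i) * θ ^ i) *
      powerSum θ l (S (vs 22))) (by rw [hev]; omega) ?_ ?_ ?_)
  · rw [hev]
    refine ⟨_, hτ0.setTemp (x := 25) l (by norm_num) (by norm_num), fun i hi => by simp [hi], ?_⟩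
    simp [powerSum_zero]
  · rw [hev]
    rintro k hk τ₀ ⟨S', I₀, hS', hsum⟩
    have I₁ := I₀.setTemp (x := 25) k (by norm_num) (by norm_num)
    set τ₁ := τ₀.setVar 25 k with hτ₁
    have hs : (Expr.op .sub (.var 7) (.lit 1)).eval τ₁ = l - 1 := by
      simp only [Expr.eval, ArithOp.apply]; rw [I₁.var7]
    have e₁ : (Expr.load (cell (.lit 1) (.op .sub (.var 7) (.lit 1)))).eval τ₁ =
        (O.code (S' 1 (l - 1))).toNat := by
      rw [I₁.eval_load (by simp only [Expr.eval]; omega) (by rw [hs]; omega), hs]; rfl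
    refine runs_seq (runs_assign (fun _ => by rw [e₁]; exact size_code_le (by omega) _) ?_)
    rw [e₁]
    have I₂ := I₁.setTemp (x := 23) (O.code (S' 1 (l - 1))).toNat (by norm_num) (by norm_num)
    set τ₂ := τ₁.setVar 23 (O.code (S' 1 (l - 1))).toNat with hτ₂
    have k₂ : (Expr.var 25).eval τ₂ = k := by simp [hτ₂, hτ₁, Expr.eval, State.setVar]
    have a₂ : (Expr.var 21).eval τ₂ = vs 21 := I₂.vars 21 (by norm_num) (by norm_num)
    have e₂ : (Expr.load (cell (.var 21) (.var 25))).eval τ₂ = (O.code (S (vs 21) k)).toNat := by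
      rw [I₂.eval_load (by rwa [a₂]) (by rwa [k₂]), k₂, a₂, hS' _ ha1]
    refine runs_seq (runs_assign (fun _ => by rw [e₂]; exact size_code_le (by omega) _) ?_)
    rw [e₂]
    have I₃ := I₂.setTemp (x := 24) (O.code (S (vs 21) k)).toNat (by norm_num) (by norm_num)
    set τ₃ := τ₂.setVar 24 (O.code (S (vs 21) k)).toNat with hτ₃
    have b₃ : τ₃.var 22 = vs 22 := I₃.vars 22 (by norm_num) (by norm_num)
    have I₄ := I₃.raise 30
    refine (I₄.hornerProgram hN (a := S (vs 21) k) (t := S' 1 (l - 1))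
      (by simp [hτ₃, hτ₂, State.setVar]) (by simp [hτ₃, State.setVar]) (by rwa [b₃])
      (by rwa [b₃])).mono ?_
    intro τ' I'
    refine ⟨?_, _, I'.lower (by norm_num) fun x hx hx' => I₃.vars x hx hx',
      fun i hi => by simp [hi, hS'], ?_⟩
    · rw [I'.vars 25 (by norm_num) (by norm_num)]
      simp [hτ₃, hτ₂, hτ₁, State.setVar]
    · rw [Function.update_self, powerSum_add, powerSum_smul,
        powerSum_shift (by omega) (by rw [hS' 0 (by norm_num)]; exact hθ), b₃, hS' _ hb1,
        sum_eq_sum_Ico_succ_bot hk]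
      rw [add_mul (_ : A), add_mul (_ : A), ← hsum]
      ring
  · rintro τ₁ - ⟨S', I₁, hS', hsum⟩
    rw [pow_zero, mul_one, ← range_eq_Ico] at hsum
    have I₂ := I₁.raise 30
    have d₁ : τ₁.var 20 = vs 20 := I₁.vars 20 (by norm_num) (by norm_num)
    refine (I₂.copyProgram hN (d := vs 20) (a := 1) ?_ (fun _ _ _ => rfl) (by omega)
      (by omega)).mono ?_
    · intro τ' S'' I'
      rw [← d₁]
      exact I'.vars 20 (by norm_num) (by norm_num)
    · intro τ' I'
      refine ⟨_, I'.lower (by norm_num) fun x hx hx' => I₁.vars x hx hx', fun i hi hi' => ?_, ?_⟩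
      · simp [hi', hS' i hi]
      · rw [Function.update_self]; exact hsum

end Specifications

end OracleRAM

/-! ### Binary digits and the recursion for circuit values -/

/-- The number with the given binary digits, the most significant digit first. -/
def bitsToNat (l : List Bool) : ℕ := l.foldl (fun c b => 2 * c + b.toNat) 0

theorem bitsToNat_concat (l : List Bool) (b : Bool) :
    bitsToNat (l ++ [b]) = 2 * bitsToNat l + b.toNat := by
  simp [bitsToNat]

/-- The `j`-th block of `b` consecutive entries. -/
def block (b : ℕ) (l : List Bool) (j : ℕ) : List Bool := (l.drop (j * b)).take b

namespace ArithCircuit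

variable {R : Type u} [CommRing R] {n s : ℕ} (C : ArithCircuit R n s)

theorem value_var (i : Fin n) : C.value i = MvPolynomial.X i := by
  rw [value, dif_pos i.2]

theorem value_gate (t : Fin s) : C.value (n + t) =
    match C.gate t with
    | .scalar c => MvPolynomial.C c
    | .add i j => C.value i + C.value j
    | .mul i j => C.value i * C.value j := by
  have h : n + (t : ℕ) - n < s := by have := t.2; omega
  rw [value, dif_neg (by omega), dif_pos h]
  have key : ∀ u : Fin s, ∀ v (h : v - n < s), u = ⟨v - n, h⟩ →
      (match C.gate ⟨v - n, h⟩ with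
        | .scalar c => MvPolynomial.C c
        | .add i j => C.value i + C.value j
        | .mul i j => C.value i * C.value j) =
      match C.gate u with
        | .scalar c => MvPolynomial.C c
        | .add i j => C.value i + C.value j
        | .mul i j => C.value i * C.value j := by
    rintro _ v h rfl
    cases C.gate ⟨v - n, h⟩ <;> rfl
  exact key t _ h (Fin.ext (by simp))

end ArithCircuit

/-! ### Programs for the stages of a round -/

namespace OracleRAM

/-- Store the first powers `θ ^ D ^ i`, where `D = 2 ^ (s + 1)`, in the slots `3 + i`. -/
def powersProgram : Program :=
  .seq (zeroProgram (.lit 2)) (.seq (.store (cell (.lit 2) (.lit 1)) (.var 6))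
    (.forDown 10 (.var 2) (.seq
      (.assign 20 (.op .add (.lit 3) (.op .sub (.op .sub (.var 2) (.lit 1)) (.var 10)))) (.seq
      (copyProgram (.var 20) (.lit 2))
      (.forDown 11 (.op .add (.var 3) (.lit 1)) (.seq
        (.assign 20 (.lit 2)) (.seq (.assign 21 (.lit 2)) (.seq (.assign 22 (.lit 2))
        mulProgram))))))))

/-- Evaluate the gate `s - 1 - i`, where the variable `10` holds `i`. -/
def gateProgram : Program :=
  .seq (.assign 11 (.op .mul (.lit 3) (.op .sub (.op .sub (.var 3) (.lit 1)) (.var 10)))) (.seq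
  (.assign 20 (.op .add (.lit 3) (.op .add (.var 2)
    (.op .sub (.op .sub (.var 3) (.lit 1)) (.var 10)))))
  (.cond (.load (.var 11))
    (.seq (.assign 21 (.op .add (.lit 3) (.load (.op .add (.var 11) (.lit 1))))) (.seq
      (.assign 22 (.op .add (.lit 3) (.load (.op .add (.var 11) (.lit 2)))))
      (.cond (.op .sub (.load (.var 11)) (.lit 1)) mulProgram addProgram)))
    (.seq (zeroProgram (.var 20))
      (.store (cell (.var 20) (.lit 0)) (.load (.op .add (.var 11) (.lit 1)))))))

/-- Set the variable `0` to `0` if the slot of the output node is not zero. -/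
def testProgram : Program :=
  let e : Expr := .load (cell (.op .add (.lit 3) (.var 4)) (.var 30))
  .forDown 30 (.var 7) (.cond (.op .add (.op .sub e (.var 5)) (.op .sub (.var 5) e))
    (.assign 0 (.lit 0)) .skip)

/-- Set the variable `31` to a random integer of the number of bits given by the variable `8`. -/
def randomScalarProgram : Program :=
  .seq (.assign 31 (.var 5)) (.forDown 30 (.var 8) (.seq
    (.ask .add 31 (.var 31) (.var 31)) (.seq (.toss 32)
    (.cond (.var 32) (.ask .add 31 (.var 31) (.var 6)) .skip))))

/-- Fill slot `0` with random integers. -/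
def randomModulusProgram : Program :=
  .forDown 10 (.var 7) (.seq randomScalarProgram
    (.store (cell (.lit 0) (.op .sub (.op .sub (.var 7) (.lit 1)) (.var 10))) (.var 31)))

section Specifications

variable {R : Type u} [CommRing R] {m n s : ℕ} {O : RingOracle R m} {C : ArithCircuit R n s}
  {L : ℕ} {σ : State} {vs : ℕ → ℕ} {cs : List Bool} {S : ℕ → ℕ → R} {N : ℕ}

theorem size_le_of_le {a : ℕ} (h : a ≤ N) : a.size ≤ N := (size_le_self a).trans h

theorem Inv.squareProgram {A : Type*} [CommRing A] [Algebra R A] {θ : A}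
    (h : Inv O C 12 σ vs cs S) (hN : wordBound m n s ≤ N)
    (hθ : θ ^ modDegree n s = powerSum θ (modDegree n s) (S 0)) :
    Runs O.query N (.seq (.assign 20 (.lit 2)) (.seq (.assign 21 (.lit 2))
      (.seq (.assign 22 (.lit 2)) OracleRAM.mulProgram))) σ fun τ => ∃ S', Inv O C 12 τ vs cs S' ∧
      (∀ i, i ≠ 1 → i ≠ 2 → S' i = S i) ∧
      powerSum θ (modDegree n s) (S' 2) = powerSum θ (modDegree n s) (S 2) ^ 2 := by
  have hN' := hN
  unfold wordBound at hN'
  refine runs_seq (runs_assign (fun _ => size_le_of_le (by simp only [Expr.eval]; omega)) ?_)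
  refine runs_seq (runs_assign (fun _ => size_le_of_le (by simp only [Expr.eval]; omega)) ?_)
  refine runs_seq (runs_assign (fun _ => size_le_of_le (by simp only [Expr.eval]; omega)) ?_)
  have h1 := ((h.setTemp (x := 20) 2 (by norm_num) (by norm_num)).setTemp (x := 21) 2
    (by norm_num) (by norm_num)).setTemp (x := 22) 2 (by norm_num) (by norm_num)
  have h2 := h1.raise 23
  set τ := ((σ.setVar 20 2).setVar 21 2).setVar 22 2 with hτ
  have e20 : τ.var 20 = 2 := by simp [hτ, State.setVar]
  have e21 : τ.var 21 = 2 := by simp [hτ, State.setVar]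
  have e22 : τ.var 22 = 2 := by simp [hτ, State.setVar]
  refine (h2.mulProgram hN hθ (by omega) (by omega) (by omega) (by omega) (by omega)).mono ?_
  rw [e20, e21, e22]
  rintro τ' ⟨S', I', hS, hp⟩
  exact ⟨S', I'.lower (by norm_num) fun x hx hx' => h1.vars x hx hx', hS, by rw [hp, sq]⟩

/-- Slot 2 runs through θ, θ^D, θ^(D^2), …, each obtained from its predecessor by s + 1 squarings,
as D = 2^(s+1). The copies in the slots 3 + i are the values of the variables under Kronecker
substitution. -/
theorem Inv.powersProgram {A : Type*} [CommRing A] [Algebra R A] {θ : A}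
    (h : Inv O C 10 σ vs cs S) (hN : wordBound m n s ≤ N)
    (hθ : θ ^ modDegree n s = powerSum θ (modDegree n s) (S 0)) :
    Runs O.query N powersProgram σ fun τ => ∃ S', Inv O C 10 τ vs cs S' ∧ S' 0 = S 0 ∧
      ∀ i < n, powerSum θ (modDegree n s) (S' (3 + i)) = θ ^ (2 ^ (s + 1)) ^ i := by
  have hN' := hN
  have hl2 : 2 ≤ modDegree n s := by simp [modDegree]
  unfold wordBound at hN'
  refine runs_seq (((h.raise 30).zeroProgram hN (d := 2) (fun _ _ _ => rfl)).mono ?_)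
  intro τ₁ I₁
  have I₂ := I₁.lower (vs := vs) (L := 10) (by norm_num) fun x hx hx' => h.vars x hx hx'
  refine runs_seq (I₂.runs_store (r := 1) (by omega) (by simp only [Expr.eval]; omega) I₂.var6 ?_)
  intro τ₂ _ I₃
  have hn : (Expr.var 2).eval τ₂ = n := I₃.var2
  refine runs_forDown (fun k τ => ∃ S', Inv O C 10 τ vs cs S' ∧ S' 0 = S 0 ∧
    (∀ i < n - k, powerSum θ (modDegree n s) (S' (3 + i)) = θ ^ (2 ^ (s + 1)) ^ i) ∧
    powerSum θ (modDegree n s) (S' 2) = θ ^ (2 ^ (s + 1)) ^ (n - k)) (by omega) ?_ ?_ ?_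
  · rw [hn]
    refine ⟨_, I₃.setTemp (x := 10) n (by norm_num) (by norm_num), by simp [Expr.eval], by simp, ?_⟩
    have : Function.update (Function.update S 2 fun _ => 0) 2
        (Function.update (fun _ => 0) 1 1) 2 = fun i => if i = 1 then (1 : R) else 0 := by
      funext i; simp [Function.update_apply]
    simp only [Expr.eval, Function.update_self] at this ⊢
    -- The residue θ has the single coordinate 1 at index 1; this index exists because l ≥ 2.
    rw [this, powerSum_single (by omega)]
    simp
  · rw [hn]
    rintro k hk τ ⟨S₁, J, hS0, hSi, hS2⟩
    have J₁ := J.setTemp (x := 10) k (by norm_num) (by norm_num)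
    set υ₁ := τ.setVar 10 k with hυ₁
    have e₁ : (Expr.op .add (.lit 3) (.op .sub (.op .sub (.var 2) (.lit 1)) (.var 10))).eval υ₁ =
        3 + (n - 1 - k) := by
      simp only [Expr.eval, ArithOp.apply, J₁.var2]
      simp [hυ₁, State.setVar]
    refine runs_seq (runs_assign (fun _ => size_le_of_le (by omega)) ?_)
    rw [e₁]
    have J₂ := J₁.setTemp (x := 20) (3 + (n - 1 - k)) (by norm_num) (by norm_num)
    set υ₂ := υ₁.setVar 20 (3 + (n - 1 - k)) with hυ₂
    have ec : υ₂.var 10 = k := by simp [hυ₂, hυ₁, State.setVar]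
    refine runs_seq (((J₂.raise 30).copyProgram hN (d := 3 + (n - 1 - k)) (a := 2) ?_
      (fun _ _ _ => rfl) (by omega) (by omega)).mono ?_)
    · intro τ' S'' I'
      rw [Expr.eval, I'.vars 20 (by norm_num) (by norm_num)]
      simp [hυ₂, State.setVar]
    intro υ₃ J₃
    have ec₃ : υ₃.var 10 = k := (J₃.vars 10 (by norm_num) (by norm_num)).trans ec
    have J₄ := J₃.lower (vs := vs) (L := 10) (by norm_num) fun x hx hx' => J₂.vars x hx hx'
    have J₅ := J₄.raise 11
    have hs : (Expr.op .add (.var 3) (.lit 1)).eval υ₃ = s + 1 := by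
      simp [Expr.eval, ArithOp.apply, J₄.var3]
    set S₂ := Function.update S₁ (3 + (n - 1 - k)) (S₁ 2) with hS₂
    have hexp : 8 * modDegree n s ≥ s + 1 := by
      rcases Nat.eq_zero_or_pos n with h0 | h0
      · omega
      · unfold modDegree; nlinarith
    refine runs_forDown (fun j τ => ∃ S', Inv O C 11 τ υ₃.var cs S' ∧
      (∀ i, i ≠ 1 → i ≠ 2 → S' i = S₂ i) ∧
      powerSum θ (modDegree n s) (S' 2) =
        (θ ^ (2 ^ (s + 1)) ^ (n - (k + 1))) ^ 2 ^ (s + 1 - j)) (by omega) ?_ ?_ ?_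
    · rw [hs]
      refine ⟨_, J₅.setTemp (x := 11) (s + 1) (by norm_num) (by norm_num), fun _ _ _ => rfl, ?_⟩
      rw [hS₂, Function.update_of_ne (by omega), hS2]
      simp
    · rw [hs]
      rintro j hj τ' ⟨S', K, hK, hp⟩
      have K₁ := (K.setTemp (x := 11) j (by norm_num) (by norm_num))
      refine ((K₁.raise 12).squareProgram (θ := θ) hN ?_).mono ?_
      · rw [hK 0 (by norm_num) (by norm_num), hS₂, Function.update_of_ne (by omega), hS0, hθ]
      rintro τ'' ⟨S'', K₂, hK₂, hp₂⟩
      refine ⟨(K₂.vars 11 (by norm_num) (by norm_num)).trans (by simp [State.setVar]), S'',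
        K₂.lower (by norm_num) fun x hx hx' => K₁.vars x hx hx',
        fun i h1 h2 => by rw [hK₂ i h1 h2, hK i h1 h2], ?_⟩
      rw [hp₂, hp, ← pow_mul (_ ^ _), ← pow_succ, show s + 1 - j = s + 1 - (j + 1) + 1 by omega]
    · rintro τ' - ⟨S', K, hK, hp⟩
      refine ⟨(K.vars 10 (by norm_num) (by norm_num)).trans ec₃, S',
        K.lower (by norm_num) fun x hx hx' => J₄.vars x hx hx', ?_, ?_, ?_⟩
      · rw [hK 0 (by norm_num) (by norm_num), hS₂, Function.update_of_ne (by omega), hS0]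
      · intro i hi
        rw [hK _ (by omega) (by omega), hS₂]
        by_cases hik : i = n - 1 - k
        · subst hik
          rw [Function.update_self, hS2, show n - (k + 1) = n - 1 - k by omega]
        · rw [Function.update_of_ne (by omega), hSi i (by omega)]
      · rw [hp, ← pow_mul θ, show n - k = n - (k + 1) + 1 by omega, pow_succ (_ ^ _)]; simp
  · rintro τ - ⟨S', J, hS0, hSi, -⟩
    exact ⟨S', J, hS0, hSi⟩

theorem inputMem_gate (t : Fin s) :
    inputMem O C (3 * t) = (gateWords O (C.gate t)).1 ∧
    inputMem O C (3 * t + 1) = (gateWords O (C.gate t)).2.1 ∧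
    inputMem O C (3 * t + 2) = (gateWords O (C.gate t)).2.2 := by
  have key : ∀ a : ℕ, a / 3 = t → inputMem O C a = (if a % 3 = 0 then
      (gateWords O (C.gate t)).1 else if a % 3 = 1 then (gateWords O (C.gate t)).2.1 else
      (gateWords O (C.gate t)).2.2) := by
    intro a h
    have h' : (⟨a / 3, h ▸ t.2⟩ : Fin s) = t := Fin.ext h
    rw [inputMem, dif_pos (h ▸ t.2), h']
  refine ⟨?_, ?_, ?_⟩
  · rw [key _ (by omega), if_pos (by omega)]
  · rw [key _ (by omega), if_neg (by omega), if_pos (by omega)]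
  · rw [key _ (by omega), if_neg (by omega), if_neg (by omega)]

theorem Inv.gateProgram {A : Type*} [CommRing A] [Algebra R A] {θ : A} {x : Fin n → A}
    (h : Inv O C 11 σ vs cs S) (hN : wordBound m n s ≤ N)
    (hθ : θ ^ modDegree n s = powerSum θ (modDegree n s) (S 0)) (t : Fin s)
    (ht : vs 10 = s - 1 - t)
    (hv : ∀ v < n + t, powerSum θ (modDegree n s) (S (3 + v)) = MvPolynomial.aeval x (C.value v)) :
    Runs O.query N gateProgram σ fun τ => ∃ S', Inv O C 11 τ vs cs S' ∧ S' 0 = S 0 ∧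
      ∀ v < n + t + 1,
        powerSum θ (modDegree n s) (S' (3 + v)) = MvPolynomial.aeval x (C.value v) := by
  have hN' := hN
  have hl2 : 2 ≤ modDegree n s := by simp [modDegree]
  unfold wordBound at hN'
  have hts := t.2
  have h8 : 3 * (s + 1) ≤ N := by
    have : (s + 1) * 2 ≤ modDegree n s * (n + s + 3) := by
      rw [mul_comm]; exact Nat.mul_le_mul hl2 (by omega)
    nlinarith
  suffices hmain : Runs O.query N OracleRAM.gateProgram σ fun τ => ∃ S', Inv O C 11 τ vs cs S' ∧
      (∀ i, i ≠ 1 → i ≠ 3 + (n + t) → S' i = S i) ∧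
      powerSum θ (modDegree n s) (S' (3 + (n + t))) = MvPolynomial.aeval x (C.value (n + t)) by
    refine hmain.mono ?_
    rintro τ ⟨S', I, hS, hp⟩
    refine ⟨S', I, hS 0 (by norm_num) (by omega), fun v hvt => ?_⟩
    rcases Nat.lt_succ_iff_lt_or_eq.1 hvt with hlt | rfl
    · rw [hS _ (by omega) (by omega), hv v hlt]
    · exact hp
  obtain ⟨w1, w2, w3⟩ := inputMem_gate (O := O) (C := C) t
  have hval := C.value_gate t
  have e10 : σ.var 10 = s - 1 - t := (h.vars 10 (by norm_num) (by norm_num)).trans ht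
  have e₁ : (Expr.op .mul (.lit 3) (.op .sub (.op .sub (.var 3) (.lit 1)) (.var 10))).eval σ =
      3 * t := by
    simp only [Expr.eval, ArithOp.apply, h.var3, e10]; omega
  refine runs_seq (runs_assign (fun _ => size_le_of_le (by omega)) ?_)
  rw [e₁]
  have J₁ := h.setTemp (x := 11) (3 * t) (by norm_num) (by norm_num)
  have e10₁ : (σ.setVar 11 (3 * t)).var 10 = s - 1 - t := by simpa [State.setVar] using e10
  have e₂ : (Expr.op .add (.lit 3) (.op .add (.var 2)
      (.op .sub (.op .sub (.var 3) (.lit 1)) (.var 10)))).eval (σ.setVar 11 (3 * t)) =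
      3 + (n + t) := by
    simp only [Expr.eval, ArithOp.apply, J₁.var3, J₁.var2, e10₁]; omega
  refine runs_seq (runs_assign (fun _ => size_le_of_le (by omega)) ?_)
  rw [e₂]
  have J₂ := J₁.setTemp (x := 20) (3 + (n + t)) (by norm_num) (by norm_num)
  set υ := (σ.setVar 11 (3 * t)).setVar 20 (3 + (n + t)) with hυ
  have e11 : υ.var 11 = 3 * t := by simp [hυ, State.setVar]
  have e20 : υ.var 20 = 3 + (n + t) := by simp [hυ, State.setVar]
  have m1 : (Expr.load (.var 11)).eval υ = (gateWords O (C.gate t)).1 := by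
    simp only [Expr.eval]; rw [e11, J₂.input _ (by omega), w1]
  have m2 : (Expr.load (.op .add (.var 11) (.lit 1))).eval υ = (gateWords O (C.gate t)).2.1 := by
    simp only [Expr.eval, ArithOp.apply]; rw [e11, J₂.input _ (by omega), w2]
  -- Both kinds of binary gates share the computation of the operand slots. The type word is 1 for
  -- addition and 2 for multiplication, so subtracting 1 tells them apart.
  have binary : ∀ i j : Fin (n + t), (gateWords O (C.gate t)).2.1 = i →
      (gateWords O (C.gate t)).2.2 = j → (gateWords O (C.gate t)).1 ≠ 0 →
      ((gateWords O (C.gate t)).1 - 1 ≠ 0 → C.value (n + t) = C.value i * C.value j) →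
      ((gateWords O (C.gate t)).1 - 1 = 0 → C.value (n + t) = C.value i + C.value j) →
      Runs O.query N
        (.seq (.assign 21 (.op .add (.lit 3) (.load (.op .add (.var 11) (.lit 1))))) (.seq
          (.assign 22 (.op .add (.lit 3) (.load (.op .add (.var 11) (.lit 2)))))
          (.cond (.op .sub (.load (.var 11)) (.lit 1)) OracleRAM.mulProgram OracleRAM.addProgram)))
        υ fun τ => ∃ S', Inv O C 11 τ vs cs S' ∧
        (∀ i, i ≠ 1 → i ≠ 3 + (n + t) → S' i = S i) ∧
        powerSum θ (modDegree n s) (S' (3 + (n + t))) =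
          MvPolynomial.aeval x (C.value (n + t)) := by
    intro i j h2 h3 h1 hmul hadd
    have hi := i.2
    have hj := j.2
    have f₁ : (Expr.op .add (.lit 3) (.load (.op .add (.var 11) (.lit 1)))).eval υ = 3 + i := by
      rw [Expr.eval, m2, h2]; rfl
    refine runs_seq (runs_assign (fun _ => size_le_of_le (by omega)) ?_)
    rw [f₁]
    have J₃ := J₂.setTemp (x := 21) (3 + i) (by norm_num) (by norm_num)
    have e11₁ : (υ.setVar 21 (3 + i)).var 11 = 3 * t := by simpa [State.setVar] using e11
    have f₂ : (Expr.op .add (.lit 3) (.load (.op .add (.var 11) (.lit 2)))).eval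
        (υ.setVar 21 (3 + i)) = 3 + j := by
      simp only [Expr.eval, ArithOp.apply]; rw [e11₁, J₃.input _ (by omega), w3, h3]
    refine runs_seq (runs_assign (fun _ => size_le_of_le (by omega)) ?_)
    rw [f₂]
    have J₄ := J₃.setTemp (x := 22) (3 + j) (by norm_num) (by norm_num)
    set φ := (υ.setVar 21 (3 + i)).setVar 22 (3 + j) with hφ
    have g11 : φ.var 11 = 3 * t := by simpa [hφ, State.setVar] using e11
    have g20 : φ.var 20 = 3 + (n + t) := by simpa [hφ, State.setVar] using e20
    have g21 : φ.var 21 = 3 + i := by simp [hφ, State.setVar]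
    have g22 : φ.var 22 = 3 + j := by simp [hφ, State.setVar]
    have f₃ : (Expr.op .sub (.load (.var 11)) (.lit 1)).eval φ =
        (gateWords O (C.gate t)).1 - 1 := by
      simp only [Expr.eval, ArithOp.apply]; rw [g11, J₄.input _ (by omega), w1]
    refine runs_cond ?_ ?_
    · rw [f₃]
      intro hne
      refine ((J₄.raise 23).mulProgram (θ := θ) hN hθ (by omega) (by omega) (by omega) (by omega)
        (by omega)).mono ?_
      rw [g20, g21, g22]
      rintro τ ⟨S', I, hS, hp⟩
      refine ⟨S', I.lower (by norm_num) fun x hx hx' => J₄.vars x hx hx', hS, ?_⟩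
      rw [hp, hv _ hi, hv _ hj, hmul hne, map_mul]
    · rw [f₃]
      intro hne
      refine ((J₄.raise 30).addProgram hN (by omega) (by omega) (by omega) (by omega)).mono ?_
      rw [g20, g21, g22]
      intro τ I
      refine ⟨_, I.lower (by norm_num) fun x hx hx' => J₄.vars x hx hx',
        fun k _ hk => by simp [hk], ?_⟩
      rw [Function.update_self, powerSum_add, hv _ hi, hv _ hj, hadd hne, map_add]
  refine runs_cond ?_ ?_
  · rw [m1]
    intro hne
    cases hg : C.gate t with
    | scalar c => simp [hg, gateWords] at hne
    | add i j =>
      rw [hg] at hval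
      exact binary i j (by simp [hg, gateWords]) (by simp [hg, gateWords]) (by simp [hg, gateWords])
        (by simp [hg, gateWords]) fun _ => hval
    | mul i j =>
      rw [hg] at hval
      exact binary i j (by simp [hg, gateWords]) (by simp [hg, gateWords]) (by simp [hg, gateWords])
        (fun _ => hval) (by simp [hg, gateWords])
  · rw [m1]
    intro hne
    cases hg : C.gate t with
    | add i j => simp [hg, gateWords] at hne
    | mul i j => simp [hg, gateWords] at hne
    | scalar c =>
      rw [hg] at hval
      refine runs_seq (((J₂.raise 30).zeroProgram hN (d := 3 + (n + t)) ?_).mono ?_)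
      · intro τ S' I
        exact (I.vars 20 (by norm_num) (by norm_num)).trans e20
      intro τ I
      have g20 : (Expr.var 20).eval τ = 3 + (n + t) :=
        (I.vars 20 (by norm_num) (by norm_num)).trans e20
      have g11 : τ.var 11 = 3 * t := (I.vars 11 (by norm_num) (by norm_num)).trans e11
      have f₁ : (Expr.load (.op .add (.var 11) (.lit 1))).eval τ = (O.code c).toNat := by
        simp only [Expr.eval, ArithOp.apply]
        rw [g11, I.input _ (by omega), w2, hg]; rfl
      refine I.runs_store (by omega) (by simp only [Expr.eval]; omega) f₁ ?_
      intro τ' _ I'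
      rw [g20] at I'
      refine ⟨_, I'.lower (by norm_num) fun x hx hx' => J₂.vars x hx hx',
        fun k _ hk => by simp [hk], ?_⟩
      have : Function.update (Function.update S (3 + (n + t)) fun _ => 0) (3 + (n + t))
          (Function.update (fun _ => 0) 0 c) (3 + (n + t)) = fun i => if i = 0 then c else 0 := by
        funext i; simp [Function.update_apply]
      simp only [Expr.eval, Function.update_self] at this ⊢
      rw [this, powerSum_single (by omega), hval]
      simp

theorem Inv.gatesProgram {A : Type*} [CommRing A] [Algebra R A] {θ : A} {x : Fin n → A}
    (h : Inv O C 10 σ vs cs S) (hN : wordBound m n s ≤ N)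
    (hθ : θ ^ modDegree n s = powerSum θ (modDegree n s) (S 0))
    (hv : ∀ v < n, powerSum θ (modDegree n s) (S (3 + v)) = MvPolynomial.aeval x (C.value v)) :
    Runs O.query N (.forDown 10 (.var 3) OracleRAM.gateProgram) σ fun τ => ∃ S',
      Inv O C 10 τ vs cs S' ∧ ∀ v < n + s,
        powerSum θ (modDegree n s) (S' (3 + v)) = MvPolynomial.aeval x (C.value v) := by
  have hN' := hN
  unfold wordBound at hN'
  have hs : (Expr.var 3).eval σ = s := h.var3
  refine runs_forDown (fun k τ => ∃ S', Inv O C 10 τ vs cs S' ∧ S' 0 = S 0 ∧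
    ∀ v < n + (s - k),
      powerSum θ (modDegree n s) (S' (3 + v)) = MvPolynomial.aeval x (C.value v)) (by omega) ?_ ?_ ?_
  · rw [hs]
    exact ⟨S, h.setTemp _ (by norm_num) (by norm_num), rfl, by simpa using hv⟩
  · rw [hs]
    rintro k hk τ ⟨S', I, hS, hp⟩
    have I₁ := I.setTemp (x := 10) k (by norm_num) (by norm_num)
    have ht : s - 1 - (s - 1 - k) = k := by omega
    refine ((I₁.raise 11).gateProgram (θ := θ) (x := x) hN (by rw [hS, hθ])
      ⟨s - 1 - k, by omega⟩ (by simp [State.setVar, ht]) ?_).mono ?_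
    · intro v hv
      exact hp v (by simp only at hv; omega)
    rintro τ' ⟨S'', I', hS', hp'⟩
    refine ⟨(I'.vars 10 (by norm_num) (by norm_num)).trans (by simp [State.setVar]), S'',
      I'.lower (by norm_num) fun x hx hx' => I₁.vars x hx hx', by rw [hS', hS], fun v hv => ?_⟩
    exact hp' v (by simp only; omega)
  · rintro τ - ⟨S', I, hS, hp⟩
    exact ⟨S', I, by simpa using hp⟩

open Classical in
theorem Inv.testProgram (h : Inv O C 10 σ vs cs S) (hN : wordBound m n s ≤ N) :
    Runs O.query N testProgram σ fun τ => Inv O C 10 τ (Function.update vs 0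
      (if ∀ j < modDegree n s, S (3 + C.out) j = 0 then vs 0 else 0)) cs S := by
  have hN' := hN
  unfold wordBound at hN'
  have hout := C.out.2
  have hl : (Expr.var 7).eval σ = modDegree n s := h.var7
  refine runs_forDown (fun k τ => Inv O C 10 τ (Function.update vs 0
    (if ∀ j, k ≤ j → j < modDegree n s → S (3 + C.out) j = 0 then vs 0 else 0)) cs S)
    (by omega) ?_ ?_ ?_
  · rw [hl, if_pos fun j hj hj' => by omega, Function.update_eq_self]
    exact h.setTemp _ (by norm_num) (by norm_num)
  · rw [hl]
    intro k hk τ I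
    have I₁ := I.setTemp (x := 30) k (by norm_num) (by norm_num)
    set υ := τ.setVar 30 k with hυ
    have e30 : (Expr.var 30).eval υ = k := by simp [hυ, Expr.eval, State.setVar]
    have eo : (Expr.op .add (.lit 3) (.var 4)).eval υ = 3 + C.out := by
      simp [Expr.eval, ArithOp.apply, I₁.var4]
    have e₁ : (Expr.load (cell (.op .add (.lit 3) (.var 4)) (.var 30))).eval υ =
        (O.code (S (3 + C.out) k)).toNat := by
      rw [I₁.eval_load (by omega) (by omega), e30, eo]
    have e5 : (Expr.var 5).eval υ = (O.code 0).toNat := I₁.var5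
    -- With truncated subtraction, (x - y) + (y - x) vanishes exactly if x = y; as codes are unique,
    -- comparing with the code of 0 decides whether the coordinate is zero.
    have hiff : (Expr.op .add (.op .sub (.load (cell (.op .add (.lit 3) (.var 4)) (.var 30)))
        (.var 5)) (.op .sub (.var 5) (.load (cell (.op .add (.lit 3) (.var 4))
        (.var 30))))).eval υ = 0 ↔ S (3 + C.out) k = 0 := by
      set e : Expr := .load (cell (.op .add (.lit 3) (.var 4)) (.var 30))
      change (e.eval υ - (Expr.var 5).eval υ) + ((Expr.var 5).eval υ - e.eval υ) = 0 ↔ _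
      rw [e₁, e5]
      constructor
      · intro h0
        exact O.code_injective (BitVec.eq_of_toNat_eq (by omega))
      · intro h0; rw [h0]; omega
    refine runs_cond ?_ ?_
    · intro hne
      rw [Ne, hiff] at hne
      refine runs_assign (fun _ => by simp [Expr.eval]) ⟨by simp [hυ, State.setVar], ?_⟩
      have I₂ := I₁.setVar (x := 0) 0 (by norm_num)
      rw [if_neg fun h' => hne (h' k le_rfl hk)]
      simpa [Expr.eval] using I₂
    · intro hz
      rw [hiff] at hz
      refine runs_skip ⟨by simp [hυ, State.setVar], ?_⟩
      have hcongr : (∀ j, k ≤ j → j < modDegree n s → S (3 + C.out) j = 0) ↔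
          ∀ j, k + 1 ≤ j → j < modDegree n s → S (3 + C.out) j = 0 := by
        refine ⟨fun h' j hj => h' j (by omega), fun h' j hj hj' => ?_⟩
        rcases Nat.eq_or_lt_of_le hj with rfl | hlt
        · exact hz
        · exact h' j hlt hj'
      rw [if_congr hcongr rfl rfl]
      exact I₁
  · intro τ _ I
    simpa using I

/-- Horner's rule on binary digits, carried out in R: doubling and adding 1 need only the oracle for
sums and the code of 1, so images of random integers are available although R itself cannot be
sampled. -/
theorem Inv.randomScalarProgram {bits rest : List Bool} (h : Inv O C 30 σ vs (bits ++ rest) S)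
    (hN : wordBound m n s ≤ N) (hbits : bits.length = m + modDegree n s) :
    Runs O.query N randomScalarProgram σ fun τ => Inv O C 30 τ vs rest S ∧
      τ.var 31 = (O.code (bitsToNat bits : R)).toNat := by
  have hN' := hN
  have hl2 : 2 ≤ modDegree n s := by simp [modDegree]
  unfold wordBound at hN'
  have e5 : (Expr.var 5).eval σ = (O.code 0).toNat := h.var5
  refine runs_seq (runs_assign (fun _ => by rw [e5]; exact size_code_le (by omega) _) ?_)
  rw [e5]
  have h1 := h.setTemp (x := 31) (O.code 0).toNat (by norm_num) (by norm_num)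
  have e8 : (Expr.var 8).eval (σ.setVar 31 (O.code 0).toNat) = m + modDegree n s := h1.var8
  refine runs_forDown (fun k τ => ∃ r u, bits = r ++ u ∧ u.length = k ∧
    Inv O C 30 τ vs (u ++ rest) S ∧ τ.var 31 = (O.code (bitsToNat r : R)).toNat)
    (by omega) ?_ ?_ ?_
  · rw [e8]
    exact ⟨[], bits, rfl, hbits, h1.setTemp _ (by norm_num) (by norm_num),
      by simp [State.setVar, bitsToNat]⟩
  · rw [e8]
    rintro k hk τ ⟨r, u, hru, hu, I, hr⟩
    obtain ⟨b, u, rfl⟩ := List.exists_cons_of_length_eq_add_one hu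
    have I₁ := I.setTemp (x := 30) k (by norm_num) (by norm_num)
    have e31 : (Expr.var 31).eval (τ.setVar 30 k) = (O.code (bitsToNat r : R)).toNat := by
      simpa [Expr.eval, State.setVar] using hr
    refine runs_seq (runs_ask_add (by omega) e31 e31 ?_)
    set c : R := (bitsToNat r : R) + (bitsToNat r : R) with hc
    have I₂ := I₁.setTemp (x := 31) (O.code c).toNat (by norm_num) (by norm_num)
    refine runs_seq (runs_toss (b := b) (bs := u ++ rest) (by omega) I₂.coins ?_)
    have I₃ := (I₂.setTemp (x := 32) b.toNat (by norm_num) (by norm_num)).setCoins (u ++ rest)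
    set υ : State := { ((τ.setVar 30 k).setVar 31 (O.code c).toNat).setVar 32 b.toNat with
      coins := u ++ rest } with hυ
    have f30 : υ.var 30 = k := by simp [hυ, State.setVar]
    have f31 : υ.var 31 = (O.code c).toNat := by simp [hυ, State.setVar]
    have f32 : υ.var 32 = b.toNat := by simp [hυ, State.setVar]
    have hu' : u.length = k := by simpa using hu
    have hcat : (bitsToNat (r ++ [b]) : R) = c + (b.toNat : R) := by
      rw [bitsToNat_concat, hc]; push_cast; ring
    refine runs_cond ?_ ?_
    · intro hne
      have hb : b = true := by
        rw [Expr.eval, f32] at hne; cases b <;> simp_all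
      refine runs_ask_add (a := c) (b := 1) (by omega) f31 I₃.var6 ?_
      refine ⟨by simpa [State.setVar] using f30, r ++ [b], u, by simpa using hru, hu',
        I₃.setTemp _ (by norm_num) (by norm_num), ?_⟩
      rw [hcat, hb]
      simp [State.setVar]
    · intro hz
      have hb : b = false := by
        rw [Expr.eval, f32] at hz; cases b <;> simp_all
      refine runs_skip ⟨f30, r ++ [b], u, by simpa using hru, hu', I₃, ?_⟩
      rw [hcat, hb, f31]
      simp
  · rintro τ - ⟨r, u, hru, hu, I, hr⟩
    obtain rfl := List.length_eq_zero_iff.1 hu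
    exact ⟨I, by rw [hr, hru, List.append_nil]⟩

theorem Inv.randomModulusProgram {bits rest : List Bool} (h : Inv O C 10 σ vs (bits ++ rest) S)
    (hN : wordBound m n s ≤ N) (hbits : bits.length = modDegree n s * (m + modDegree n s)) :
    Runs O.query N randomModulusProgram σ fun τ => ∃ S', Inv O C 10 τ vs rest S' ∧
      ∀ j < modDegree n s, S' 0 j = (bitsToNat (block (m + modDegree n s) bits j) : R) := by
  have hN' := hN
  unfold wordBound at hN'
  set l := modDegree n s with hl
  set w := m + l with hw
  have e7 : (Expr.var 7).eval σ = l := h.var7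
  refine runs_forDown (fun k τ => ∃ S', Inv O C 10 τ vs (bits.drop ((l - k) * w) ++ rest) S' ∧
    ∀ j < l - k, S' 0 j = (bitsToNat (block w bits j) : R)) (by omega) ?_ ?_ ?_
  · rw [e7]
    exact ⟨S, by simpa using h.setTemp _ (by norm_num) (by norm_num), by simp⟩
  · rw [e7]
    rintro k hk τ ⟨S', I, hS⟩
    have I₁ := I.setTemp (x := 10) k (by norm_num) (by norm_num)
    have hidx : l - k = l - 1 - k + 1 := by omega
    have hidx' : l - (k + 1) = l - 1 - k := by omega
    rw [hidx'] at hS I₁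
    have hsplit : bits.drop ((l - 1 - k) * w) = block w bits (l - 1 - k) ++
        bits.drop ((l - k) * w) := by
      rw [block, hidx, add_mul, one_mul, ← List.drop_drop, List.take_append_drop]
    have hlen : (block w bits (l - 1 - k)).length = w := by
      have : (l - 1 - k) * w + w ≤ l * w := by
        rw [← Nat.succ_mul]; gcongr; omega
      rw [block, List.length_take, List.length_drop, hbits]; omega
    rw [hsplit, List.append_assoc] at I₁
    refine runs_seq (((I₁.raise 30).randomScalarProgram hN hlen).mono ?_)
    rintro τ₁ ⟨I₂, h31⟩
    have f10 : τ₁.var 10 = k :=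
      (I₂.vars 10 (by norm_num) (by norm_num)).trans (by simp [State.setVar])
    have fidx : (Expr.op .sub (.op .sub (.var 7) (.lit 1)) (.var 10)).eval τ₁ = l - 1 - k := by
      simp only [Expr.eval, ArithOp.apply, f10, I₂.var7]; rfl
    refine I₂.runs_store (by omega) (by rw [fidx]; omega) h31 ?_
    intro τ' hτ' I'
    rw [fidx] at I'
    refine ⟨by rw [hτ', f10], _, I'.lower (by norm_num) fun x hx hx' => I₁.vars x hx hx', ?_⟩
    intro j hj
    simp only [Expr.eval, Function.update_self]
    by_cases hjk : j = l - 1 - k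
    · subst hjk; simp
    · rw [Function.update_of_ne hjk, hS j (by omega)]
  · rintro τ - ⟨S', I, hS⟩
    have : bits.drop ((l - 0) * w) = [] := List.drop_eq_nil_of_le (by rw [hbits]; simp)
    rw [this] at I
    exact ⟨S', by simpa using I, by simpa using hS⟩

end Specifications

end OracleRAM

/-! ### The quotient by a monic modulus -/

section Modulus

variable {R : Type*} [CommRing R]

open Polynomial in
/-- The monic polynomial `X ^ l - ∑ j < l, q j * X ^ j`. -/
noncomputable def modulus (l : ℕ) (q : ℕ → R) : R[X] :=
  X ^ l - ∑ j ∈ range l, C (q j) * X ^ j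

open Polynomial in
theorem degree_sum_range_lt (l : ℕ) (v : ℕ → R) :
    (∑ j ∈ range l, C (v j) * X ^ j).degree < (l : WithBot ℕ) := by
  refine (degree_sum_le _ _).trans_lt ((Finset.sup_lt_iff (WithBot.bot_lt_coe l)).2 fun j hj => ?_)
  exact (degree_C_mul_X_pow_le _ _).trans_lt (WithBot.coe_lt_coe.2 (mem_range.1 hj))

theorem modulus_monic (l : ℕ) (q : ℕ → R) : (modulus l q).Monic :=
  Polynomial.monic_X_pow_sub (degree_sum_range_lt l q)

theorem modulus_degree [Nontrivial R] (l : ℕ) (q : ℕ → R) : (modulus l q).degree = l := by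
  rw [modulus, Polynomial.degree_sub_eq_left_of_degree_lt, Polynomial.degree_X_pow]
  rw [Polynomial.degree_X_pow]
  exact degree_sum_range_lt l q

theorem modulus_congr {l : ℕ} {q q' : ℕ → R} (h : ∀ j < l, q j = q' j) :
    modulus l q = modulus l q' := by
  rw [modulus, modulus, sum_congr rfl fun j hj => by rw [h j (mem_range.1 hj)]]

theorem modulus_map {S : Type*} [CommRing S] (f : R →+* S) (l : ℕ) (q : ℕ → R) :
    (modulus l q).map f = modulus l fun j => f (q j) := by
  simp [modulus, Polynomial.map_sum]

open Polynomial in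
theorem powerSum_root (g : R[X]) (l : ℕ) (v : ℕ → R) :
    powerSum (AdjoinRoot.root g) l v = AdjoinRoot.mk g (∑ j ∈ range l, C (v j) * X ^ j) := by
  simp [powerSum, AdjoinRoot.algebraMap_eq]

theorem root_modulus_pow (l : ℕ) (q : ℕ → R) :
    AdjoinRoot.root (modulus l q) ^ l = powerSum (AdjoinRoot.root (modulus l q)) l q := by
  rw [powerSum_root, ← AdjoinRoot.mk_X, ← map_pow, AdjoinRoot.mk_eq_mk]
  exact dvd_rfl

/-- A monic polynomial of degree l divides no nonzero polynomial of smaller degree, over any ring.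
Hence the coordinates of a residue are unique and the coordinatewise test for zero is exact. -/
theorem powerSum_root_modulus_eq_zero {l : ℕ} {q v : ℕ → R} :
    powerSum (AdjoinRoot.root (modulus l q)) l v = 0 ↔ ∀ j < l, v j = 0 := by
  refine ⟨fun h => ?_, fun h => by rw [powerSum_congr h, powerSum_zero]⟩
  nontriviality R
  rw [powerSum_root, AdjoinRoot.mk_eq_zero] at h
  have h0 : ∑ j ∈ range l, Polynomial.C (v j) * Polynomial.X ^ j = 0 := by
    by_contra hne
    refine (modulus_monic l q).not_dvd_of_degree_lt hne ?_ h
    exact (degree_sum_range_lt l v).trans_eq (modulus_degree l q).symm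
  intro j hj
  have := congrArg (fun p => Polynomial.coeff p j) h0
  simpa [Polynomial.finsetSum_coeff, Polynomial.coeff_C_mul, Polynomial.coeff_X_pow, hj] using this

open Polynomial in
/-- Kronecker substitution. -/
noncomputable def kronecker (n D : ℕ) : MvPolynomial (Fin n) R →ₐ[R] R[X] :=
  MvPolynomial.aeval fun i => X ^ D ^ (i : ℕ)

theorem aeval_root_pow (g : Polynomial R) {n : ℕ} (D : ℕ) (f : MvPolynomial (Fin n) R) :
    MvPolynomial.aeval (fun i : Fin n => AdjoinRoot.root g ^ D ^ (i : ℕ)) f =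
      AdjoinRoot.mk g (kronecker n D f) := by
  have : (MvPolynomial.aeval fun i : Fin n => AdjoinRoot.root g ^ D ^ (i : ℕ)) =
      (AdjoinRoot.mkₐ g).comp (kronecker n D) := by
    ext i; simp [kronecker]
  rw [this]; rfl

end Modulus

/-! ### The complete test program -/

namespace OracleRAM

/-- One test of the polynomial modulo a random monic polynomial. -/
def roundProgram : Program :=
  .seq randomModulusProgram (.seq powersProgram (.seq (.forDown 10 (.var 3) gateProgram)
    testProgram))

/-- Fill all slots with zeros. -/
def initProgram : Program :=
  .forDown 30 (.op .mul (.var 7) (.op .add (.op .add (.var 2) (.var 3)) (.lit 3)))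
    (.store (.op .add (.op .mul (.lit 3) (.var 3)) (.var 30)) (.var 5))

/-- The randomized identity test. -/
def identityTest : Program :=
  .seq (.assign 0 (.lit 1)) (.seq
  (.assign 7 (.op .add (.op .mul (.op .add (.var 3) (.lit 1)) (.var 2)) (.lit 2))) (.seq
  (.assign 8 (.op .add (.var 1) (.var 7))) (.seq initProgram
  (.forDown 9 (.op .mul (.lit 8) (.var 7)) roundProgram))))

section Specifications

variable {R : Type u} [CommRing R] {m n s : ℕ} {O : RingOracle R m} {C : ArithCircuit R n s}
  {L : ℕ} {σ : State} {vs : ℕ → ℕ} {cs : List Bool} {S : ℕ → ℕ → R} {N : ℕ}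

/-- The test modulo the polynomial given by the random bits does not notice that the polynomial of
the circuit is not zero. -/
def Passes {R : Type u} [CommRing R] {n s : ℕ} (C : ArithCircuit R n s) (w : ℕ)
    (bits : List Bool) : Prop :=
  modulus (modDegree n s) (fun j => (bitsToNat (block w bits j) : R)) ∣
    kronecker n (2 ^ (s + 1)) C.poly

open Classical in
theorem Inv.roundProgram {bits rest : List Bool} (h : Inv O C 10 σ vs (bits ++ rest) S)
    (hN : wordBound m n s ≤ N) (hbits : bits.length = modDegree n s * (m + modDegree n s)) :
    Runs O.query N roundProgram σ fun τ => ∃ S', Inv O C 10 τ (Function.update vs 0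
      (if Passes C (m + modDegree n s) bits then vs 0 else 0)) rest S' := by
  refine runs_seq ((h.randomModulusProgram hN hbits).mono ?_)
  rintro τ₁ ⟨S₁, I₁, hS₁⟩
  set g : Polynomial R := modulus (modDegree n s)
    (fun j => (bitsToNat (block (m + modDegree n s) bits j) : R)) with hg
  have hθ : AdjoinRoot.root g ^ modDegree n s =
      powerSum (AdjoinRoot.root g) (modDegree n s) (S₁ 0) := by
    rw [powerSum_congr hS₁, hg, root_modulus_pow]
  refine runs_seq ((I₁.powersProgram hN hθ).mono ?_)
  rintro τ₂ ⟨S₂, I₂, h0, hp⟩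
  refine runs_seq ((I₂.gatesProgram (θ := AdjoinRoot.root g)
    (x := fun i : Fin n => AdjoinRoot.root g ^ (2 ^ (s + 1)) ^ (i : ℕ)) hN (by rw [h0, hθ]) ?_).mono
    ?_)
  · intro v hv
    rw [hp v hv, C.value_var ⟨v, hv⟩, MvPolynomial.aeval_X]
  rintro τ₃ ⟨S₃, I₃, hv⟩
  refine (I₃.testProgram hN).mono fun τ I => ⟨S₃, ?_⟩
  -- The output slot holds the class of the Kronecker image in R[X]/(g), and this class is zero
  -- exactly if g divides the image.
  have hiff : (∀ j < modDegree n s, S₃ (3 + C.out) j = 0) ↔ Passes C (m + modDegree n s) bits := by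
    have h1 := hv C.out C.out.2
    rw [← powerSum_root_modulus_eq_zero
      (q := fun j => (bitsToNat (block (m + modDegree n s) bits j) : R)), ← hg, h1, aeval_root_pow,
      AdjoinRoot.mk_eq_zero]
    rfl
  rwa [if_congr hiff rfl rfl] at I

/-- The invariant demands that every slot cell hold the code of a ring element, since oracle answers
to other strings are arbitrary. Filling with zeros establishes this. -/
theorem runs_initProgram (hN : wordBound m n s ≤ N) (h1 : σ.var 1 = m) (h2 : σ.var 2 = n)
    (h3 : σ.var 3 = s) (h4 : σ.var 4 = C.out) (h5 : σ.var 5 = (O.code 0).toNat)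
    (h6 : σ.var 6 = (O.code 1).toNat) (h7 : σ.var 7 = modDegree n s)
    (h8 : σ.var 8 = m + modDegree n s) (hin : ∀ a < 3 * s, σ.mem a = inputMem O C a) :
    Runs O.query N initProgram σ fun τ => Inv O C 9 τ σ.var σ.coins fun _ _ => 0 := by
  have hN' := hN
  unfold wordBound at hN'
  have he : (Expr.op .mul (.var 7) (.op .add (.op .add (.var 2) (.var 3)) (.lit 3))).eval σ =
      modDegree n s * (n + s + 3) := by
    simp [Expr.eval, ArithOp.apply, h2, h3, h7]
  refine runs_forDown (fun k τ => (∀ x, x ≠ 30 → τ.var x = σ.var x) ∧ τ.coins = σ.coins ∧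
    (∀ a < 3 * s, τ.mem a = σ.mem a) ∧ ∀ i, k ≤ i → i < modDegree n s * (n + s + 3) →
      τ.mem (3 * s + i) = (O.code 0).toNat) (by omega) ?_ ?_ ?_
  · rw [he]
    exact ⟨fun x hx => by simp [State.setVar, hx], rfl, fun _ _ => rfl, fun i hi hi' => by omega⟩
  · rw [he]
    rintro k hk τ ⟨t1, t2, t3, t4⟩
    have ht : ∀ x, x ≠ 30 → (τ.setVar 30 k).var x = σ.var x := fun x hx => by
      simp [State.setVar, hx, t1]
    have ha : (Expr.op .add (.op .mul (.lit 3) (.var 3)) (.var 30)).eval (τ.setVar 30 k) =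
        3 * s + k := by
      simp only [Expr.eval, ArithOp.apply, ht 3 (by norm_num), h3]
      simp [State.setVar]
    have hz : (Expr.var 5).eval (τ.setVar 30 k) = (O.code 0).toNat :=
      (ht 5 (by norm_num)).trans h5
    refine runs_store (fun _ => by rw [hz]; exact size_code_le (by omega) _) ?_
    rw [ha, hz]
    refine ⟨by simp [State.setVar, State.setMem], ht, t2, fun a ha => ?_, fun i hi hi' => ?_⟩
    · simp only [State.setMem]
      rw [Function.update_of_ne (by omega)]
      exact t3 a ha
    · simp only [State.setMem]
      by_cases hik : i = k
      · subst hik; simp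
      · rw [Function.update_of_ne (by omega)]
        exact t4 i (by omega) hi'
  · rintro τ - ⟨t1, t2, t3, t4⟩
    refine ⟨?_, ?_, ?_, ?_, ?_, ?_, ?_, ?_, fun x hx _ => t1 x (by omega), t2,
      fun a ha => by rw [t3 a ha, hin a ha], fun k hk j hj => ?_⟩
    iterate 8 (rw [t1 _ (by norm_num)]; assumption)
    rw [add_assoc, t4 _ (by omega)]
    calc modDegree n s * k + j < modDegree n s * k + modDegree n s := by omega
      _ = modDegree n s * (k + 1) := by ring
      _ ≤ _ := Nat.mul_le_mul_left _ (by omega)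

/-- The number of coin tosses in a round. -/
def roundBits (m n s : ℕ) : ℕ := modDegree n s * (m + modDegree n s)

open Classical in
theorem runs_identityTest (hN : wordBound m n s ≤ N)
    (hcs : 8 * modDegree n s * roundBits m n s ≤ cs.length) :
    Runs O.query N identityTest (inputState O C cs) fun τ => τ.var 0 =
      if ∀ i < 8 * modDegree n s, Passes C (m + modDegree n s) (block (roundBits m n s) cs i)
      then 1 else 0 := by
  have hN' := hN
  unfold wordBound at hN'
  set l := modDegree n s with hl
  set W := roundBits m n s with hW
  refine runs_seq (runs_assign (fun _ => size_le_of_le (by simp only [Expr.eval]; omega)) ?_)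
  have e7 : (Expr.op .add (.op .mul (.op .add (.var 3) (.lit 1)) (.var 2)) (.lit 2)).eval
      ((inputState O C cs).setVar 0 1) = l := rfl
  refine runs_seq (runs_assign (fun _ => size_le_of_le (by change l ≤ N; omega)) ?_)
  refine runs_seq (runs_assign (fun _ => size_le_of_le (by change m + l ≤ N; omega)) ?_)
  refine runs_seq ((runs_initProgram (O := O) (C := C) hN rfl rfl rfl rfl rfl rfl rfl rfl
    fun _ _ => rfl).mono ?_)
  intro τ I
  -- At level 9 the answer variable 0 is the only recorded one, so a constant function describes the
  -- values.
  have I' : Inv O C 9 τ (fun _ => 1) cs fun _ _ => (0 : R) := by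
    refine I.lower le_rfl fun x hx hx' => ?_
    obtain rfl : x = 0 := by omega
    rfl
  have e9 : (Expr.op .mul (.lit 8) (.var 7)).eval τ = 8 * l := by
    simp [Expr.eval, ArithOp.apply, I'.var7, hl]
  refine runs_forDown (fun k τ => ∃ S, Inv O C 9 τ (fun _ => if ∀ i < 8 * l - k,
    Passes C (m + l) (block W cs i) then 1 else 0) (cs.drop ((8 * l - k) * W)) S)
    (by omega) ?_ ?_ ?_
  · rw [e9]
    exact ⟨_, by simpa using I'.setTemp _ (by norm_num) (by norm_num)⟩
  · rw [e9]
    rintro k hk τ ⟨S, J⟩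
    have J₁ := J.setTemp (x := 9) k (by norm_num) (by norm_num)
    have hidx : 8 * l - k = 8 * l - (k + 1) + 1 := by omega
    have hsplit : cs.drop ((8 * l - (k + 1)) * W) = block W cs (8 * l - (k + 1)) ++
        cs.drop ((8 * l - k) * W) := by
      rw [block, hidx, add_mul, one_mul, ← List.drop_drop, List.take_append_drop]
    have hlen : (block W cs (8 * l - (k + 1))).length = W := by
      have : (8 * l - (k + 1)) * W + W ≤ 8 * l * W := by
        rw [← Nat.succ_mul]; gcongr; omega
      rw [block, List.length_take, List.length_drop]; omega
    rw [hsplit] at J₁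
    refine ((J₁.raise 10).roundProgram hN hlen).mono ?_
    rintro τ' ⟨S', J'⟩
    refine ⟨?_, S', J'.lower (by norm_num) fun x hx hx' => ?_⟩
    · rw [J'.vars 9 (by norm_num) (by norm_num)]; simp [State.setVar]
    · obtain rfl : x = 0 := by omega
      rw [Function.update_self, J₁.vars 0 (by norm_num) (by norm_num)]
      rw [← ite_and]
      refine if_congr ?_ rfl rfl
      rw [hidx]
      constructor
      · rintro ⟨h1, h2⟩ i hi
        rcases Nat.lt_succ_iff_lt_or_eq.1 hi with hlt | rfl
        · exact h2 i hlt
        · exact h1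
      · intro h'
        exact ⟨h' _ (by omega), fun i hi => h' i (by omega)⟩
  · rintro τ - ⟨S, J⟩
    simpa using J.vars 0 (by norm_num) (by norm_num)

end Specifications

end OracleRAM

/-! ### Passing to a residue field -/

section Reduction

open Polynomial

/-- A nonzero polynomial over a finite ring has a nonzero shadow over a residue field, such that
divisibility by monic polynomials is inherited. -/
theorem exists_field_forall_monic_dvd {R : Type u} [CommRing R] [Finite R] {g : R[X]}
    (hg : g ≠ 0) : ∃ (k : Type u) (_ : Field k) (φ : R →+* k) (h : k[X]),
      Function.Surjective φ ∧ h ≠ 0 ∧ h.natDegree ≤ g.natDegree ∧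
      ∀ Q : R[X], Q.Monic → Q ∣ g → Q.map φ ∣ h := by
  -- I is maximal among the ideals that do not contain all coefficients of g; the zero ideal is one
  -- of them.
  obtain ⟨I, ⟨i₀, hI⟩, hmax⟩ := set_has_maximal_iff_noetherian.2 (inferInstance : IsNoetherian R R)
    {I : Ideal R | ∃ i, g.coeff i ∉ I} (by
      obtain ⟨i, hi⟩ := not_forall.1 (mt (fun h => Polynomial.ext h) hg)
      exact ⟨⊥, i, by simpa using hi⟩)
  set c := g.coeff i₀ with hc
  -- An ideal strictly above I contains all coefficients, so modulo I each coefficient is a multiple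
  -- of any given nonzero element.
  have hmem : ∀ x, x ∉ I → ∀ i, ∃ y, g.coeff i - y * x ∈ I := by
    intro x hx i
    have hlt : I < I ⊔ Ideal.span {x} := lt_of_le_of_ne le_sup_left fun h =>
      hx (h ▸ Ideal.mem_sup_right (Ideal.mem_span_singleton_self x))
    have hall : g.coeff i ∈ I ⊔ Ideal.span {x} := by
      by_contra hi
      exact hmax _ ⟨i, hi⟩ hlt
    obtain ⟨a, ha, b, hb, hab⟩ := Submodule.mem_sup.1 hall
    obtain ⟨y, rfl⟩ := Ideal.mem_span_singleton'.1 hb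
    exact ⟨y, by rw [← hab]; simpa using ha⟩
  -- P is the colon ideal (I : c). It is maximal: if x c is not in I, then c is a multiple y x c
  -- modulo I, so that 1 - y x lies in P.
  set P : Ideal R := Submodule.comap (LinearMap.mulRight R c) I with hP
  have memP : ∀ x, x ∈ P ↔ x * c ∈ I := fun x => Iff.rfl
  have hPmax : P.IsMaximal := by
    refine Ideal.isMaximal_iff.2 ⟨by simpa [memP] using hI, fun J x hPJ hx hxJ => ?_⟩
    obtain ⟨y, hy⟩ := hmem (x * c) hx i₀
    have h1 : 1 - y * x ∈ P := by
      rw [memP]; convert hy using 1; ring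
    have := J.add_mem (hPJ h1) (J.mul_mem_left y hxJ)
    simpa using this
  choose y hy using hmem c hI
  let F : Field (R ⧸ P) := Ideal.Quotient.field P
  set g₀ : R[X] := ∑ i ∈ range (g.natDegree + 1), C (y i) * X ^ i with hg₀
  have hg₀c : ∀ i ≤ g.natDegree, g₀.coeff i = y i := by
    intro i hi
    simp [hg₀, finsetSum_coeff, coeff_X_pow, Nat.lt_succ_of_le hi]
  have hg₀d : g₀.natDegree ≤ g.natDegree := by
    refine natDegree_sum_le_of_forall_le _ _ fun i hi => ?_
    exact (natDegree_C_mul_X_pow_le _ _).trans (Nat.lt_succ_iff.1 (mem_range.1 hi))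
  -- Modulo I the polynomial g is c g₀, and the annihilator of c modulo I is P; this makes g₀ modulo
  -- P the right shadow of g.
  have hgI : g.map (Ideal.Quotient.mk I) = (C c * g₀).map (Ideal.Quotient.mk I) := by
    ext i
    rw [coeff_map, coeff_map, coeff_C_mul]
    by_cases hi : i ≤ g.natDegree
    · rw [hg₀c i hi, Ideal.Quotient.eq, mul_comm c]
      exact hy i
    · rw [coeff_eq_zero_of_natDegree_lt (by omega),
        coeff_eq_zero_of_natDegree_lt (hg₀d.trans_lt (by omega)), mul_zero]
  refine ⟨R ⧸ P, F, Ideal.Quotient.mk P, g₀.map (Ideal.Quotient.mk P),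
    Ideal.Quotient.mk_surjective, ?_, (natDegree_map_le).trans hg₀d, ?_⟩
  · intro h0
    have h1 := congrArg (fun f => f.coeff i₀) h0
    have hi₀ : i₀ ≤ g.natDegree := le_natDegree_of_ne_zero fun h =>
      hI (by rw [hc, h]; exact I.zero_mem)
    simp only [coeff_map, coeff_zero, hg₀c i₀ hi₀] at h1
    rw [Ideal.Quotient.eq_zero_iff_mem, memP] at h1
    have := I.add_mem (hy i₀) h1
    exact hI (by simpa using this)
  · intro Q hQ hdvd
    have hnt : Nontrivial (R ⧸ I) := Ideal.Quotient.nontrivial_iff.2 fun h => hI (h ▸ trivial)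
    have hmod := modByMonic_add_div g₀ Q
    set r := g₀ %ₘ Q with hr
    -- Modulo I, the monic Q divides c g₀ and hence c r, whose degree is smaller than that of Q. So
    -- c r vanishes modulo I, which puts the coefficients of r into P.
    have hr0 : (C c * r).map (Ideal.Quotient.mk I) = 0 := by
      by_contra hne
      have hnt' : Nontrivial R := (Ideal.Quotient.mk I).domain_nontrivial
      refine (hQ.map (Ideal.Quotient.mk I)).not_dvd_of_degree_lt hne ?_ ?_
      · rw [hQ.degree_map]
        refine (degree_map_le.trans ?_).trans_lt (degree_modByMonic_lt g₀ hQ)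
        simpa using (degree_mul_le (C c) r).trans (add_le_add_left degree_C_le r.degree)
      · have h1 := Polynomial.map_dvd (Ideal.Quotient.mk I) hdvd
        rw [hgI, ← hmod, mul_add, Polynomial.map_add, mul_left_comm,
          Polynomial.map_mul (p := Q)] at h1
        exact (dvd_add_left ⟨_, rfl⟩).1 h1
    have hrP : r.map (Ideal.Quotient.mk P) = 0 := by
      ext i
      have h1 := congrArg (fun f => f.coeff i) hr0
      simp only [coeff_map, coeff_zero, coeff_C_mul] at h1
      rw [Ideal.Quotient.eq_zero_iff_mem, mul_comm, ← memP] at h1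
      rw [coeff_map, coeff_zero, Ideal.Quotient.eq_zero_iff_mem]
      exact h1
    rw [← hmod, Polynomial.map_add, hrP, zero_add, Polynomial.map_mul]
    exact dvd_mul_right _ _

/-! ### Counting moduli over the prime field -/

/-- Extend a vector of residues to a sequence of natural numbers. -/
def residueSeq {p l : ℕ} (q : Fin l → ZMod p) (j : ℕ) : ℕ := if h : j < l then (q ⟨j, h⟩).val else 0

theorem eval_modulus {k : Type*} [CommRing k] (l : ℕ) (q : ℕ → k) (a : k) :
    (modulus l q).eval a = a ^ l - ∑ j ∈ range l, q j * a ^ j := by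
  simp [modulus, eval_finsetSum]

/-- By Cayley–Hamilton, a is a root of the characteristic polynomial of multiplication by a. Unlike
the minimal polynomial, this has degree exactly l for every a. -/
theorem exists_modulus_eval_eq_zero {p l : ℕ} [Fact p.Prime] (hl : l ≠ 0) (a : GaloisField p l) :
    ∃ q : Fin l → ZMod p,
      (modulus l fun j => (residueSeq q j : GaloisField p l)).eval a = 0 := by
  set f := Algebra.lmul (ZMod p) (GaloisField p l) a with hf
  have hdeg : f.charpoly.natDegree = l := by
    rw [LinearMap.charpoly_natDegree, GaloisField.finrank p hl]
  have h0 : aeval a f.charpoly = 0 := by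
    have h1 := LinearMap.aeval_self_charpoly f
    rw [hf, aeval_algHom_apply] at h1
    exact Algebra.lmul_injective (by rw [h1, map_zero])
  have hsum := f.charpoly_monic.as_sum
  rw [hdeg] at hsum
  refine ⟨fun j => - f.charpoly.coeff j, ?_⟩
  rw [eval_modulus]
  rw [hsum] at h0
  simp only [map_add, map_pow, aeval_X, map_sum, map_mul, aeval_C] at h0
  rw [sub_eq_add_neg, ← sum_neg_distrib]
  refine Eq.trans ?_ h0
  congr 1
  refine sum_congr rfl fun j hj => ?_
  have hp : NeZero p := ⟨(Fact.out : p.Prime).ne_zero⟩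
  have : ((-f.charpoly.coeff j).val : GaloisField p l) =
      algebraMap (ZMod p) (GaloisField p l) (-f.charpoly.coeff j) := by
    rw [← map_natCast (algebraMap (ZMod p) (GaloisField p l)), ZMod.natCast_zmod_val]
  simp only [residueSeq, mem_range.1 hj, dif_pos]
  rw [this, map_neg, neg_mul, neg_neg]

open Classical in
-- Embed the field with p^l elements into an algebraic closure of k. At least p^l - d of its
-- elements are not roots of h; the modulus chosen to vanish at such an element cannot divide h, and
-- it is chosen for at most l elements, all of them being its roots.
theorem card_not_modulus_dvd {k : Type*} [Field k] {p l d : ℕ} [Fact p.Prime] [CharP k p]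
    (hl : l ≠ 0) {h : k[X]} (hh : h ≠ 0) (hd : h.natDegree ≤ d) :
    p ^ l ≤ d + l * #{q : Fin l → ZMod p | ¬ modulus l (fun j => (residueSeq q j : k)) ∣ h} := by
  have : NeZero p := ⟨(Fact.out : p.Prime).ne_zero⟩
  let K := AlgebraicClosure k
  have : CharP K p := charP_of_injective_algebraMap (algebraMap k K).injective p
  let _ : Algebra (ZMod p) K := ZMod.algebra K p
  let F := GaloisField p l
  let _ : Fintype F := Fintype.ofFinite F
  let ι : F →ₐ[ZMod p] K := IsAlgClosed.lift
  have hι : Function.Injective ι := ι.toRingHom.injective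
  let hK := h.map (algebraMap k K)
  have hK0 : hK ≠ 0 := (Polynomial.map_ne_zero_iff (algebraMap k K).injective).2 hh
  set Z : Finset F := {a | hK.eval (ι a) = 0} with hZ
  have hZcard : #Z ≤ d := by
    have h1 : Z.image ι ⊆ hK.roots.toFinset := by
      intro b hb
      obtain ⟨a, ha, rfl⟩ := mem_image.1 hb
      simpa [hK0] using (mem_filter.1 ha).2
    calc #Z = #(Z.image ι) := (card_image_of_injective _ hι).symm
      _ ≤ #hK.roots.toFinset := card_le_card h1
      _ ≤ hK.roots.card := Multiset.toFinset_card_le _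
      _ ≤ hK.natDegree := card_roots' _
      _ ≤ d := natDegree_map_le.trans hd
  choose q hq using exists_modulus_eval_eq_zero (p := p) hl
  have himage : (Zᶜ).image q ⊆
      ({q : Fin l → ZMod p | ¬ modulus l (fun j => (residueSeq q j : k)) ∣ h} : Finset _) := by
    intro b hb
    obtain ⟨a, ha, rfl⟩ := mem_image.1 hb
    refine mem_filter.2 ⟨mem_univ _, fun hdvd => ?_⟩
    have h1 := eval_dvd (x := ι a) (Polynomial.map_dvd (algebraMap k K) hdvd)
    have h2 := congrArg ι (hq a)
    rw [map_zero, eval_modulus] at h2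
    rw [modulus_map, eval_modulus] at h1
    simp only [map_sub, map_pow, map_sum, map_mul, map_natCast] at h1 h2
    have hcast : ∀ x : ℕ, ι (x : GaloisField p l) = x := fun x => map_natCast ι x
    simp only [hcast] at h2
    rw [h2, zero_dvd_iff] at h1
    exact (mem_compl.1 ha) (mem_filter.2 ⟨mem_univ _, h1⟩)
  have hfiber : #(Zᶜ) ≤ l * #((Zᶜ).image q) := by
    refine card_le_mul_card_image _ _ fun b _ => ?_
    have hM := modulus_monic (R := F) l fun j => (residueSeq b j : F)
    have h1 : ({a ∈ Zᶜ | q a = b} : Finset F) ⊆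
        (modulus l fun j => (residueSeq b j : F)).roots.toFinset := by
      intro a ha
      have := hq a
      rw [(mem_filter.1 ha).2] at this
      simpa [hM.ne_zero] using this
    calc _ ≤ _ := card_le_card h1
      _ ≤ _ := Multiset.toFinset_card_le _
      _ ≤ _ := card_roots' _
      _ = l := natDegree_eq_of_degree_eq_some (modulus_degree _ _)
  have hcard : #(Zᶜ) + #Z = p ^ l := by
    rw [add_comm, card_add_card_compl, ← GaloisField.card p l hl, Nat.card_eq_fintype_card]
  have := Nat.mul_le_mul_left l (card_le_card himage)
  omega

end Reduction

/-! ### Kronecker substitution and degrees of circuits -/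

section Kronecker

variable {R : Type*} [CommRing R] {n D : ℕ}

/-- The exponent that Kronecker substitution gives to a monomial. -/
def kroneckerExp (D : ℕ) (e : Fin n →₀ ℕ) : ℕ := ∑ i, e i * D ^ (i : ℕ)

/-- When all exponents are below D, they are the base-D digits of the Kronecker exponent; uniqueness
of digits then keeps distinct monomials apart. -/
theorem kroneckerExp_eq (e : Fin n →₀ ℕ) (he : ∀ i, e i < D) :
    kroneckerExp D e = (finFunctionFinEquiv fun i => (⟨e i, he i⟩ : Fin D) : ℕ) := by
  rw [finFunctionFinEquiv_apply, kroneckerExp]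

theorem kroneckerExp_lt (e : Fin n →₀ ℕ) (he : ∀ i, e i < D) : kroneckerExp D e < D ^ n := by
  rw [kroneckerExp_eq e he]
  exact Fin.isLt _

theorem kroneckerExp_injOn {e e' : Fin n →₀ ℕ} (he : ∀ i, e i < D) (he' : ∀ i, e' i < D)
    (h : kroneckerExp D e = kroneckerExp D e') : e = e' := by
  rw [kroneckerExp_eq e he, kroneckerExp_eq e' he'] at h
  have := finFunctionFinEquiv.injective (Fin.ext h)
  ext i
  simpa using congrArg Fin.val (congrFun this i)

theorem kronecker_eq_sum (f : MvPolynomial (Fin n) R) :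
    kronecker n D f = ∑ e ∈ f.support, Polynomial.C (f.coeff e) *
      Polynomial.X ^ kroneckerExp D e := by
  conv_lhs => rw [← f.support_sum_monomial_coeff]
  rw [map_sum]
  refine sum_congr rfl fun e _ => ?_
  rw [kronecker, MvPolynomial.aeval_monomial, Finsupp.prod_fintype _ _ (by simp),
    Polynomial.algebraMap_eq, kroneckerExp, ← prod_pow_eq_pow_sum]
  simp only [← pow_mul, mul_comm]

theorem natDegree_kronecker_lt {f : MvPolynomial (Fin n) R} (hf : ∀ i, f.degreeOf i < D)
    (hD : 0 < D) : (kronecker n D f).natDegree < D ^ n := by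
  have hpos : 0 < D ^ n := by positivity
  suffices h : (kronecker n D f).natDegree ≤ D ^ n - 1 by omega
  rw [kronecker_eq_sum]
  refine Polynomial.natDegree_sum_le_of_forall_le _ _ fun e he => ?_
  refine (Polynomial.natDegree_C_mul_X_pow_le _ _).trans ?_
  have := kroneckerExp_lt e fun i => (MvPolynomial.monomial_le_degreeOf i he).trans_lt (hf i)
  omega

theorem kronecker_ne_zero {f : MvPolynomial (Fin n) R} (hf : ∀ i, f.degreeOf i < D)
    (h0 : f ≠ 0) : kronecker n D f ≠ 0 := by
  obtain ⟨e, he⟩ := MvPolynomial.support_nonempty.2 h0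
  intro h
  have h1 := congrArg (fun g => g.coeff (kroneckerExp D e)) h
  simp only [kronecker_eq_sum, Polynomial.finsetSum_coeff, Polynomial.coeff_C_mul_X_pow,
    Polynomial.coeff_zero] at h1
  rw [sum_eq_single e] at h1
  · exact MvPolynomial.mem_support_iff.1 he (by simpa using h1)
  · intro e' he' hne
    refine if_neg fun h' => hne ?_
    exact (kroneckerExp_injOn
      (fun i => (MvPolynomial.monomial_le_degreeOf i he).trans_lt (hf i))
      (fun i => (MvPolynomial.monomial_le_degreeOf i he').trans_lt (hf i)) h').symm
  · exact fun h' => absurd he h'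

end Kronecker

namespace ArithCircuit

variable {R : Type u} [CommRing R] {n s : ℕ} (C : ArithCircuit R n s)

/-- Variables have degree at most 1, and each further gate at most doubles the largest degree so
far, the worst case being a squaring. -/
theorem degreeOf_value_le (i : Fin n) (t : ℕ) (ht : t ≤ s) :
    ∀ v < n + t, (C.value v).degreeOf i ≤ 2 ^ t := by
  induction t with
  | zero =>
    intro v hv
    rw [C.value_var ⟨v, hv⟩]
    refine (MvPolynomial.degreeOf_le_totalDegree _ _).trans ?_
    exact MvPolynomial.totalDegree_monomial_le _ _ |>.trans (by simp)
  | succ t ih =>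
    intro v hv
    have ih := ih (by omega)
    rcases Nat.lt_succ_iff_lt_or_eq.1 hv with hlt | rfl
    · exact (ih v hlt).trans (Nat.pow_le_pow_right (by norm_num) (by omega))
    · have hval := C.value_gate ⟨t, ht⟩
      change (C.value (n + ((⟨t, ht⟩ : Fin s) : ℕ))).degreeOf i ≤ _
      rw [hval]
      have h2 : 2 ^ (t + 1) = 2 ^ t + 2 ^ t := by ring
      cases C.gate ⟨t, ht⟩ with
      | scalar c => simp
      | add j k =>
        refine (MvPolynomial.degreeOf_add_le _ _ _).trans ?_
        have := ih j j.2
        have := ih k k.2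
        simp only [sup_le_iff]; omega
      | mul j k =>
        refine (MvPolynomial.degreeOf_mul_le _ _ _).trans ?_
        have := ih j j.2
        have := ih k k.2
        omega

theorem degreeOf_poly_lt (i : Fin n) : C.poly.degreeOf i < 2 ^ (s + 1) :=
  (C.degreeOf_value_le i s le_rfl _ C.out.2).trans_lt (Nat.pow_lt_pow_right (by norm_num) (by omega))

end ArithCircuit

/-! ### Residues of random integers and independent blocks -/

section Bits

theorem exists_bitsToNat_eq (w x : ℕ) (hx : x < 2 ^ w) :
    ∃ L : List Bool, L.length = w ∧ bitsToNat L = x := by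
  induction w generalizing x with
  | zero => exact ⟨[], rfl, by simp only [pow_zero] at hx; simp only [bitsToNat, List.foldl]; omega⟩
  | succ w ih =>
    obtain ⟨L, hL, hx'⟩ := ih (x / 2) (by rw [pow_succ] at hx; omega)
    refine ⟨L ++ [decide (x % 2 = 1)], by simp [hL], ?_⟩
    rw [bitsToNat_concat, hx']
    rcases Nat.mod_two_eq_zero_or_one x with h | h <;> simp [h] <;> omega

theorem exists_bitsToNat_block_eq (w l : ℕ) (x : ℕ → ℕ) (hx : ∀ j < l, x j < 2 ^ w) :
    ∃ L : List Bool, L.length = l * w ∧ ∀ j < l, bitsToNat (block w L j) = x j := by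
  induction l with
  | zero => exact ⟨[], by simp, by simp⟩
  | succ l ih =>
    obtain ⟨L, hL, hj⟩ := ih fun j hj => hx j (by omega)
    obtain ⟨E, hE, hEx⟩ := exists_bitsToNat_eq w (x l) (hx l (by omega))
    refine ⟨L ++ E, by rw [List.length_append, hL, hE]; ring, fun j hjl => ?_⟩
    rcases Nat.lt_succ_iff_lt_or_eq.1 hjl with hlt | rfl
    · have h1 : j * w + w ≤ l * w := by
        rw [← Nat.succ_mul]; exact Nat.mul_le_mul_right w hlt
      rw [← hj j hlt, block, block, List.drop_append_of_le_length (by omega),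
        List.take_append_of_le_length (by rw [List.length_drop]; omega)]
    · rw [block, ← hL, List.drop_left, ← hE, List.take_length, hEx]

theorem exists_ofFn_eq {a : ℕ} {L : List Bool} (h : L.length = a) :
    ∃ r : Fin a → Bool, List.ofFn r = L := by
  subst h
  exact ⟨L.get, List.ofFn_get L⟩

open Classical in
/-- If a property holds for all lists of `l` integers of `w` bits with residues modulo `p` in `G`,
then it holds for many bit strings. -/
theorem card_residues_le {p w l : ℕ} (hp : p ≠ 0) (G : Finset (Fin l → ZMod p))
    (P : List Bool → Prop)
    (hP : ∀ q ∈ G, ∀ L, (∀ j, ∀ h : j < l, (bitsToNat (block w L j) : ZMod p) = q ⟨j, h⟩) → P L) :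
    (2 ^ w / p) ^ l * #G ≤ #{r : Fin (l * w) → Bool | P (List.ofFn r)} := by
  have : NeZero p := ⟨hp⟩
  -- A residue q_j and a quotient u_j below ⌊2^w / p⌋ give the integer q_j + p u_j below 2^w, from
  -- which both are recovered. So each residue vector comes from at least ⌊2^w / p⌋^l bit strings.
  have hex : ∀ y : (Fin l → Fin (2 ^ w / p)) × (Fin l → ZMod p), ∃ r : Fin (l * w) → Bool,
      ∀ j, ∀ h : j < l, bitsToNat (block w (List.ofFn r) j) =
        (y.2 ⟨j, h⟩).val + p * (y.1 ⟨j, h⟩ : ℕ) := by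
    intro y
    obtain ⟨L, hL, hj⟩ := exists_bitsToNat_block_eq w l
      (fun j => if h : j < l then (y.2 ⟨j, h⟩).val + p * (y.1 ⟨j, h⟩ : ℕ) else 0) (by
        intro j hj
        rw [dif_pos hj]
        have h1 := ZMod.val_lt (y.2 ⟨j, hj⟩)
        have h2 := (y.1 ⟨j, hj⟩).2
        calc _ < p * ((y.1 ⟨j, hj⟩ : ℕ) + 1) := by rw [mul_add]; omega
          _ ≤ p * (2 ^ w / p) := Nat.mul_le_mul_left p h2
          _ ≤ 2 ^ w := Nat.mul_div_le _ _)
    obtain ⟨r, rfl⟩ := exists_ofFn_eq hL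
    exact ⟨r, fun j h => by rw [hj j h, dif_pos h]⟩
  choose F hF using hex
  have hval : ∀ y j (h : j < l), (bitsToNat (block w (List.ofFn (F y)) j) : ZMod p) =
      y.2 ⟨j, h⟩ := fun y j h => by simp [hF y j h]
  have hinj : Function.Injective F := by
    intro y z hyz
    have h2 : y.2 = z.2 := by
      ext j
      rw [← hval y j j.2, ← hval z j j.2, hyz]
    refine Prod.ext (funext fun j => Fin.ext ?_) h2
    have h3 := hF y j j.2
    rw [hyz, hF z j j.2, h2] at h3
    exact (Nat.eq_of_mul_eq_mul_left (Nat.pos_of_ne_zero hp) (Nat.add_left_cancel h3)).symm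
  calc (2 ^ w / p) ^ l * #G = #((univ : Finset (Fin l → Fin (2 ^ w / p))) ×ˢ G) := by
        simp [card_product]
    _ = #(((univ : Finset (Fin l → Fin (2 ^ w / p))) ×ˢ G).image F) :=
        (card_image_of_injective _ hinj).symm
    _ ≤ _ := card_le_card fun r hr => by
        obtain ⟨y, hy, rfl⟩ := mem_image.1 hr
        exact mem_filter.2 ⟨mem_univ _, hP _ (mem_product.1 hy).2 _ (hval y)⟩

theorem block_ofFn {W K e : ℕ} (r : Fin (K * W + e) → Bool) (i : Fin K) :
    block W (List.ofFn r) i = List.ofFn fun t : Fin W => r ⟨i * W + t, by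
      have : (i : ℕ) * W + W ≤ K * W := by
        rw [← Nat.succ_mul]; exact Nat.mul_le_mul_right W i.2
      omega⟩ := by
  have h1 : (i : ℕ) * W + W ≤ K * W := by
    rw [← Nat.succ_mul]; exact Nat.mul_le_mul_right W i.2
  refine List.ext_getElem ?_ fun t h _ => ?_
  · simp only [block, List.length_take, List.length_drop, List.length_ofFn]; omega
  · simp [block]

open Classical in
/-- Independent trials: a bound for the number of bit strings all of whose first `K` blocks have a
property. -/
theorem card_forall_block_le (W K e : ℕ) (P : List Bool → Prop) :
    #{r : Fin (K * W + e) → Bool | ∀ i < K, P (block W (List.ofFn r) i)} ≤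
      #{x : Fin W → Bool | P (List.ofFn x)} ^ K * 2 ^ e := by
  let B := {x : Fin W → Bool // P (List.ofFn x)}
  have hlt : ∀ (i : Fin K) (t : Fin W), (i : ℕ) * W + t < K * W + e := fun i t => by
    have : (i : ℕ) * W + W ≤ K * W := by
      rw [← Nat.succ_mul]; exact Nat.mul_le_mul_right W i.2
    omega
  -- Cut the string into K blocks, each with the property, and an unrestricted tail of e bits.
  let F : {r : Fin (K * W + e) → Bool // ∀ i < K, P (block W (List.ofFn r) i)} →
      (Fin K → B) × (Fin e → Bool) := fun r =>
    (fun i => ⟨fun t => r.1 ⟨i * W + t, hlt i t⟩, by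
      have := r.2 i i.2
      rwa [block_ofFn] at this⟩, fun t => r.1 (Fin.natAdd _ t))
  have hF : Function.Injective F := by
    intro r r' h
    refine Subtype.ext (funext fun x => ?_)
    have h1 := congrArg Prod.fst h
    have h2 := congrArg Prod.snd h
    refine Fin.addCases (fun y => ?_) (fun y => congrFun h2 y) x
    have hy := y.2
    have hW : 0 < W := by
      rcases Nat.eq_zero_or_pos W with h0 | h0
      · simp [h0] at hy
      · exact h0
    have h3 := congrFun (congrArg Subtype.val (congrFun h1 ⟨y / W, Nat.div_lt_of_lt_mul
      (hy.trans_eq (mul_comm _ _))⟩)) ⟨y % W, Nat.mod_lt _ hW⟩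
    have hidx : (Fin.castAdd e y) = (⟨(y : ℕ) / W * W + y % W, by
        rw [Nat.div_add_mod']; omega⟩ : Fin (K * W + e)) :=
      Fin.ext (by simp [Nat.div_add_mod'])
    rw [hidx]
    exact h3
  have := Fintype.card_le_of_injective F hF
  simpa [B, Fintype.card_subtype] using this

end Bits

/-! ### Success probability -/

section Probability

variable {R : Type u} [CommRing R] {m n s : ℕ}

open Classical in
/-- A round detects a nonzero polynomial with noticeable probability. -/
theorem two_pow_le_card_not_passes [Finite R] (O : RingOracle R m) (C : ArithCircuit R n s)
    (h0 : C.poly ≠ 0) :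
    2 ^ OracleRAM.roundBits m n s ≤ 4 * modDegree n s *
      #{r : Fin (OracleRAM.roundBits m n s) → Bool |
        ¬ OracleRAM.Passes C (m + modDegree n s) (List.ofFn r)} := by
  set l := modDegree n s with hl
  have hl0 : l ≠ 0 := by simp [hl, modDegree]
  obtain ⟨k, _, φ, h, hφ, hh, hhd, hdvd⟩ := exists_field_forall_monic_dvd
    (kronecker_ne_zero C.degreeOf_poly_lt h0)
  have : Finite k := Finite.of_surjective φ hφ
  obtain ⟨p, hchar⟩ := CharP.exists k
  have hprime : Fact p.Prime := ⟨CharP.char_is_prime k p⟩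
  have hp0 : p ≠ 0 := hprime.out.ne_zero
  -- The prime field embeds into k, k is a quotient of R, and the elements of R have distinct codes
  -- of m bits. Thus m bounds the unknown p.
  have hpm : p ≤ 2 ^ m := by
    have hk : p ≤ Nat.card k := by
      have := Nat.card_le_card_of_injective _ (ZMod.castHom (dvd_refl p) k).injective
      simpa using this
    have hR : Nat.card k ≤ Nat.card R := Nat.card_le_card_of_surjective φ hφ
    have hc : Nat.card R ≤ Nat.card (BitVec m) :=
      Nat.card_le_card_of_injective O.code O.code_injective
    have hbv : Nat.card (BitVec m) ≤ 2 ^ m := by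
      have := Nat.card_le_card_of_injective (fun x : BitVec m => (⟨x.toNat, x.isLt⟩ : Fin (2 ^ m)))
        fun x y hxy => BitVec.eq_of_toNat_eq (congrArg Fin.val hxy)
      simpa using this
    omega
  -- This bound (2^(s+1))^n = 2^(l-2) dictates the choice of l.
  have hd : h.natDegree ≤ 2 ^ (l - 2) := by
    refine hhd.trans (natDegree_kronecker_lt C.degreeOf_poly_lt (by positivity)).le |>.trans ?_
    rw [← pow_mul]
    simp [hl, modDegree]
  have hcount := card_not_modulus_dvd (p := p) hl0 hh hd
  set G : Finset (Fin l → ZMod p) :=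
    {q : Fin l → ZMod p | ¬ modulus l (fun j => (residueSeq q j : k)) ∣ h} with hG
  have hbits := card_residues_le (w := m + l) hp0 G
    (fun L => ¬ OracleRAM.Passes C (m + l) L) (by
      intro q hq L hL hpass
      refine (mem_filter.1 hq).2 ?_
      have h1 := hdvd _ (modulus_monic _ _) hpass
      rw [modulus_map] at h1
      convert h1 using 1
      refine modulus_congr fun j hj => ?_
      rw [map_natCast, CharP.natCast_eq_natCast k p, ← ZMod.natCast_eq_natCast_iff, hL j hj]
      simp [residueSeq, hj])
  set good := #{r : Fin (OracleRAM.roundBits m n s) → Bool |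
        ¬ OracleRAM.Passes C (m + l) (List.ofFn r)} with hgood
  replace hbits : (2 ^ (m + l) / p) ^ l * #G ≤ good := by
    refine hbits.trans_eq ?_
    rw [hgood]
    unfold OracleRAM.roundBits
    congr!
  set a := 2 ^ (m + l) / p with ha
  -- the residues of the random integers are almost uniformly distributed
  have hunif : 2 ^ OracleRAM.roundBits m n s ≤ 2 * (a * p) ^ l := by
    have h1 : 2 ^ (m + l) ≤ a * p + 2 ^ m := by
      have h0 : a * p + 2 ^ (m + l) % p = 2 ^ (m + l) := Nat.div_add_mod' _ _
      have := Nat.mod_lt (2 ^ (m + l)) (Nat.pos_of_ne_zero hp0)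
      omega
    -- The l bits beyond m make the part lost by rounding down at most 2^(-l) of the whole; by
    -- Bernoulli's inequality, l coordinates together lose at most l 2^(-l) ≤ 1/2.
    have h2 : (2 : ℝ) ^ (m + l) * (1 + -(1 / 2 ^ l)) ≤ (a * p : ℕ) := by
      have h3 : (2 : ℝ) ^ (m + l) ≤ (a * p : ℕ) + 2 ^ m := by exact_mod_cast h1
      have h4 : (2 : ℝ) ^ (m + l) * (1 + -(1 / 2 ^ l)) = 2 ^ (m + l) - 2 ^ m := by
        rw [pow_add]; field_simp; ring
      linarith
    have hinv : (1 : ℝ) / 2 ^ l ≤ 1 := by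
      rw [div_le_one (by positivity)]; exact one_le_pow₀ (by norm_num)
    have h5 := one_add_mul_le_pow (a := -(1 / (2 : ℝ) ^ l)) (by linarith) l
    have h6 : (l : ℝ) * (1 / 2 ^ l) ≤ 1 / 2 := by
      have h7 : l + 1 ≤ 2 ^ l := Nat.lt_two_pow_self
      have h8 : 2 * l ≤ 2 ^ l := by
        obtain ⟨i, hi⟩ := Nat.exists_eq_succ_of_ne_zero hl0
        have : i + 1 ≤ 2 ^ i := Nat.lt_two_pow_self
        rw [hi, pow_succ]; omega
      have h9 : (2 : ℝ) * l ≤ 2 ^ l := by exact_mod_cast h8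
      rw [mul_one_div, div_le_iff₀ (by positivity)]
      linarith
    have h7 : ((2 : ℝ) ^ (m + l) * (1 + -(1 / 2 ^ l))) ^ l ≤ ((a * p : ℕ) : ℝ) ^ l :=
      pow_le_pow_left₀ (mul_nonneg (by positivity) (by linarith)) h2 l
    rw [mul_pow, ← pow_mul] at h7
    have h8 : (2 : ℝ) ^ ((m + l) * l) * (1 / 2) ≤ ((a * p : ℕ) : ℝ) ^ l :=
      (mul_le_mul_of_nonneg_left (by linarith) (by positivity)).trans h7
    have h9 : (2 : ℝ) ^ OracleRAM.roundBits m n s ≤ 2 * ((a * p : ℕ) : ℝ) ^ l := by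
      rw [OracleRAM.roundBits, ← hl, mul_comm l]; linarith
    exact_mod_cast h9
  have hpl : 2 * 2 ^ (l - 2) ≤ p ^ l := by
    calc 2 * 2 ^ (l - 2) = 2 ^ (l - 2 + 1) := by ring
      _ ≤ 2 ^ l := Nat.pow_le_pow_right (by norm_num) (by omega)
      _ ≤ p ^ l := Nat.pow_le_pow_left hprime.out.two_le l
  -- In the factor 4l, one 2 pays for the nonuniform residues, the other for the roots of h (at most
  -- half of the p^l elements), and l for the roots shared by a modulus.
  calc 2 ^ OracleRAM.roundBits m n s ≤ 2 * (a * p) ^ l := hunif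
    _ = 2 * a ^ l * p ^ l := by rw [mul_pow]; ring
    _ ≤ 2 * a ^ l * (2 * (l * #G)) := Nat.mul_le_mul_left _ (by omega)
    _ = 4 * l * (a ^ l * #G) := by ring
    _ ≤ 4 * l * good := Nat.mul_le_mul_left _ hbits

/-- The exponent 8l gives e^(-2) by 1 + x ≤ e^x, and e^2 ≥ 1 + 2 by the same inequality. -/
theorem one_sub_pow_le {l : ℕ} (hl : 2 ≤ l) : (1 - 1 / (4 * l : ℝ)) ^ (8 * l) ≤ 1 / 3 := by
  have hl' : (2 : ℝ) ≤ l := by exact_mod_cast hl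
  have h0 : (1 : ℝ) / (4 * l) ≤ 1 := by
    rw [div_le_one (by positivity)]; linarith
  have h1 : (1 - 1 / (4 * l : ℝ)) ≤ Real.exp (-(1 / (4 * l))) := by
    have := Real.add_one_le_exp (-(1 / (4 * l : ℝ)))
    linarith
  calc _ ≤ Real.exp (-(1 / (4 * l))) ^ (8 * l) := pow_le_pow_left₀ (by linarith) h1 _
    _ = Real.exp (-2) := by
      rw [← Real.exp_nat_mul]
      congr 1
      push_cast
      field_simp
      norm_num
    _ ≤ 1 / 3 := by
      rw [Real.exp_neg, one_div]
      refine inv_anti₀ (by norm_num) ?_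
      have := Real.add_one_le_exp (2 : ℝ)
      linarith

open Classical in
theorem two_thirds_le [Finite R] (O : RingOracle R m) (C : ArithCircuit R n s)
    (h0 : C.poly ≠ 0) {T : ℕ} (hT : 8 * modDegree n s * OracleRAM.roundBits m n s ≤ T) :
    (2 : ℝ) / 3 ≤ (#{r : Fin T → Bool | ¬ ∀ i < 8 * modDegree n s, OracleRAM.Passes C
      (m + modDegree n s) (block (OracleRAM.roundBits m n s) (List.ofFn r) i)} : ℝ) / 2 ^ T := by
  -- The e surplus coins are not used in any round and contribute the same factor 2^e to both
  -- counts.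
  obtain ⟨e, rfl⟩ := Nat.exists_eq_add_of_le hT
  set l := modDegree n s with hl
  have hl2 : 2 ≤ l := by simp [hl, modDegree]
  have hl' : (2 : ℝ) ≤ l := by exact_mod_cast hl2
  set W := OracleRAM.roundBits m n s with hW
  have hgood := two_pow_le_card_not_passes O C h0
  have hbad := card_forall_block_le W (8 * l) e (OracleRAM.Passes C (m + l))
  have hsplit := card_filter_add_card_filter_not (s := (univ : Finset (Fin W → Bool)))
    fun r => OracleRAM.Passes C (m + l) (List.ofFn r)
  have hsplitT := card_filter_add_card_filter_not
    (s := (univ : Finset (Fin (8 * l * W + e) → Bool)))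
    fun r => ∀ i < 8 * l, OracleRAM.Passes C (m + l) (block W (List.ofFn r) i)
  rw [← hl, ← hW] at hgood
  rw [card_univ, Fintype.card_fun, Fintype.card_fin, Fintype.card_bool] at hsplit hsplitT
  set b := #{r : Fin W → Bool | OracleRAM.Passes C (m + l) (List.ofFn r)} with hb
  set g := #{r : Fin W → Bool | ¬ OracleRAM.Passes C (m + l) (List.ofFn r)} with hg
  set B := #{r : Fin (8 * l * W + e) → Bool | ∀ i < 8 * l,
    OracleRAM.Passes C (m + l) (block W (List.ofFn r) i)} with hB
  set A := #{r : Fin (8 * l * W + e) → Bool | ¬ ∀ i < 8 * l,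
    OracleRAM.Passes C (m + l) (block W (List.ofFn r) i)} with hA
  have hgood' : (2 : ℝ) ^ W ≤ 4 * l * g := by exact_mod_cast hgood
  have hsplit' : (b : ℝ) + g = 2 ^ W := by exact_mod_cast hsplit
  have hsplitT' : (B : ℝ) + A = 2 ^ (8 * l * W + e) := by exact_mod_cast hsplitT
  have hbad' : (B : ℝ) ≤ b ^ (8 * l) * 2 ^ e := by exact_mod_cast hbad
  have h1 : (b : ℝ) ≤ 2 ^ W * (1 - 1 / (4 * l)) := by
    have h2 : (2 : ℝ) ^ W * (1 / (4 * l)) ≤ g := by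
      rw [mul_one_div, div_le_iff₀ (by positivity)]; linarith
    linarith
  have h2 : (b : ℝ) ^ (8 * l) ≤ 2 ^ (8 * l * W) * (1 / 3) := by
    calc (b : ℝ) ^ (8 * l) ≤ (2 ^ W * (1 - 1 / (4 * l))) ^ (8 * l) :=
          pow_le_pow_left₀ (by positivity) h1 _
      _ = 2 ^ (8 * l * W) * (1 - 1 / (4 * l)) ^ (8 * l) := by
          rw [mul_pow, ← pow_mul, mul_comm W]
      _ ≤ _ := mul_le_mul_of_nonneg_left (one_sub_pow_le hl2) (by positivity)
  have h3 : (B : ℝ) ≤ 2 ^ (8 * l * W + e) * (1 / 3) := by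
    calc (B : ℝ) ≤ b ^ (8 * l) * 2 ^ e := hbad'
      _ ≤ 2 ^ (8 * l * W) * (1 / 3) * 2 ^ e := mul_le_mul_of_nonneg_right h2 (by positivity)
      _ = _ := by rw [pow_add]; ring
  rw [le_div_iff₀ (by positivity)]
  linarith

end Probability

/-! ### Time bound and conclusion -/

section Test

variable {R : Type u} [CommRing R] {m n s : ℕ}

open Polynomial in
/-- A polynomial bound for `wordBound` in terms of the sum of the arguments. -/
noncomputable def wordBoundPoly : ℕ[X] :=
  ((X + 1) * X + 2) * (X + 3) + 8 * ((X + 1) * X + 2) + X + 3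

theorem wordBound_le (m n s : ℕ) : wordBound m n s ≤ wordBoundPoly.eval (n + s + m) := by
  have h : modDegree n s ≤ (n + s + m + 1) * (n + s + m) + 2 := by
    unfold modDegree; gcongr <;> omega
  have h2 : modDegree n s * (n + s + 3) ≤ ((n + s + m + 1) * (n + s + m) + 2) * (n + s + m + 3) := by
    exact Nat.mul_le_mul h (by omega)
  simp only [wordBoundPoly, Polynomial.eval_add, Polynomial.eval_mul, Polynomial.eval_X,
    Polynomial.eval_one, Polynomial.eval_ofNat, wordBound]
  omega

theorem bounded_inputState (O : RingOracle R m) (C : ArithCircuit R n s) (cs : List Bool) {N : ℕ}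
    (hN : wordBound m n s ≤ N) : OracleRAM.Bounded N (inputState O C cs) := by
  unfold wordBound at hN
  refine ⟨fun x => ?_, fun a => ?_⟩
  · have hout := C.out.2
    have h5 := OracleRAM.size_code_le (O := O) (N := N) (by omega)
    have key : ∀ y ≤ N, y.size ≤ N := fun y hy => OracleRAM.size_le_of_le hy
    change (inputVar O C x).size ≤ N
    unfold inputVar
    split
    · exact key _ (by omega)
    · exact key _ (by omega)
    · exact key _ (by omega)
    · exact key _ (by omega)
    · exact h5 0
    · exact h5 1
    · exact key _ (by omega)
  · have h5 := OracleRAM.size_code_le (O := O) (N := N) (by omega)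
    have key : ∀ y ≤ n + s + 2, y.size ≤ N := fun y hy => OracleRAM.size_le_of_le (by omega)
    change (inputMem O C a).size ≤ N
    unfold inputMem
    split
    · rename_i h
      cases hg : C.gate ⟨a / 3, h⟩ with
      | scalar c =>
        simp only [gateWords]
        split_ifs
        · exact key _ (by omega)
        · exact h5 c
        · exact key _ (by omega)
      | add i j =>
        have := i.2
        have := j.2
        simp only [gateWords]
        split_ifs <;> exact key _ (by simp only at *; omega)
      | mul i j =>
        have := i.2
        have := j.2
        simp only [gateWords]
        split_ifs <;> exact key _ (by simp only at *; omega)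
    · exact key _ (by omega)

/-- A polynomial bound for the running time of the identity test. -/
noncomputable def testTime : Polynomial ℕ :=
  (OracleRAM.identityTest.time + Polynomial.X ^ 3).comp wordBoundPoly

theorem testsZeroWithin_identityTest [Finite R] (O : RingOracle R m) (C : ArithCircuit R n s) :
    TestsZeroWithin OracleRAM.identityTest O C (testTime.eval (C.size + m)) := by
  classical
  set N := wordBoundPoly.eval (n + s + m) with hNdef
  have hN : wordBound m n s ≤ N := wordBound_le m n s
  set T := testTime.eval (C.size + m) with hT
  have hTN : T = OracleRAM.identityTest.time.eval N + N ^ 3 := by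
    simp [hT, testTime, ArithCircuit.size, hNdef]
  -- A toss without remaining coins has no transition, so T must cover all tosses; the summand X^3
  -- in `testTime` ensures this.
  have hcoins : 8 * modDegree n s * OracleRAM.roundBits m n s ≤ T := by
    have h1 : 8 * modDegree n s ≤ N := by unfold wordBound at hN; omega
    have h2 : modDegree n s ≤ N := by omega
    have h3 : m + modDegree n s ≤ N := by unfold wordBound at hN; omega
    calc 8 * modDegree n s * (modDegree n s * (m + modDegree n s)) ≤ N * (N * N) := by gcongr
      _ = N ^ 3 := by ring
      _ ≤ T := by omega
  have hrun : ∀ r : Fin T → Bool, Answers OracleRAM.identityTest O C T (List.ofFn r)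
      (if ∀ i < 8 * modDegree n s, OracleRAM.Passes C (m + modDegree n s)
        (block (OracleRAM.roundBits m n s) (List.ofFn r) i) then 1 else 0) := by
    intro r
    obtain ⟨t, ht, σ, h1, -, h2⟩ := OracleRAM.runs_identityTest (O := O) (C := C) hN
      (by rwa [List.length_ofFn]) (bounded_inputState O C (List.ofFn r) hN)
    exact ⟨t, by omega, σ, h1, h2⟩
  refine ⟨fun r => ?_, fun h0 r => ?_, fun h0 => ?_⟩
  · have := hrun r
    split_ifs at this with h
    · exact Or.inr this
    · exact Or.inl this
  · have := hrun r
    rwa [if_pos fun i _ => by rw [OracleRAM.Passes, h0, map_zero]; exact dvd_zero _] at this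
  · refine (two_thirds_le O C h0 hcoins).trans ?_
    rw [answerProb]
    gcongr
    rw [Nat.card_eq_fintype_card, Fintype.card_subtype]
    refine card_le_card fun r hr => mem_filter.2 ⟨mem_univ _, ?_⟩
    have := hrun r
    rwa [if_neg (mem_filter.1 hr).2] at this

end Test

theorem mainTheorem4 :
    ∃ P : OracleRAM.Program,
      -- time polynomial in the circuit size and the length `m` of the codes
      (∃ p : Polynomial ℕ,
        ∀ (R : Type u) [CommRing R] [Finite R] (m : ℕ) (O : RingOracle R m)
          (n s : ℕ) (C : ArithCircuit R n s),
          ∃ T ≤ p.eval (C.size + m), TestsZeroWithin P O C T) ∧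
      -- for codes of length polynomial in `log |R|`: time polynomial in the size and `log |R|`
      (∀ b : Polynomial ℕ, ∃ p : Polynomial ℕ,
        ∀ (R : Type u) [CommRing R] [Finite R] (m : ℕ) (O : RingOracle R m)
          (n s : ℕ) (C : ArithCircuit R n s), m ≤ b.eval (Nat.clog 2 (Nat.card R)) →
          ∃ T ≤ p.eval (C.size + Nat.clog 2 (Nat.card R)), TestsZeroWithin P O C T) := by
  have hmono : ∀ (p : Polynomial ℕ) {x y : ℕ}, x ≤ y → p.eval x ≤ p.eval y := by
    intro p x y hxy
    rw [Polynomial.eval_eq_sum_range, Polynomial.eval_eq_sum_range]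
    exact sum_le_sum fun i _ => by gcongr
  refine ⟨OracleRAM.identityTest, ⟨testTime, fun R _ _ m O n s C =>
    ⟨_, le_rfl, testsZeroWithin_identityTest O C⟩⟩, fun b => ⟨testTime.comp (Polynomial.X + b),
    fun R _ _ m O n s C hm => ⟨_, ?_, testsZeroWithin_identityTest O C⟩⟩⟩
  rw [Polynomial.eval_comp, Polynomial.eval_add, Polynomial.eval_X]
  -- With y the sum of the size and log |R|, the size plus m is at most y + b(y), because
  -- polynomials over ℕ are monotone.
  refine hmono _ ?_
  have := hmono b (Nat.le_add_left (Nat.clog 2 (Nat.card R)) C.size)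
  omega
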